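/- Let $G$ be a groupoid, $P\subseteq G$ a wide subcategory, $P(x,y)$ the set of morphisms in $P$ with source $x$ and target $y$, $P(-,y)=\bigcup_x P(x,y)$, $P(-,-)=\bigcup_y P(-,y)$, and write $s(f),t(f)$ for the source and target of $f$ and $f\le g$ if $t(f)=t(g)$ and $f^{-1}g\in P$. Assume that $(G,P)$ is a quasi-lattice ordered groupoid: if $f$ and $f^{-1}$ both lie in $P$ then $f$ is an identity, and every nonempty finite set of morphisms of $G$ that has an upper bound in $P$ has a least upper bound in $P$. Let $X=(\{A_x\},\{X_f\})$ be a product system over $(G,P)$: $A_x$ is a C*-algebra for each object $x$; for $f\in P(-,-)$, $X_f$ is an $A_{t(f)}$-$A_{s(f)}$ C*-correspondence (a right Hilbert $A_{s(f)}$-module with a nondegenerate $*$-homomorphism $\phi_f:A_{t(f)}\to\mathcal L(X_f)$); for $s(g)=t(f)$ there is a unitary of correspondences $m_{g,f}:X_g\otimes_{A_{t(f)}}X_f\to X_{gf}$; these are associative, $X_{1_x}=A_x$, and $m_{1_x,f}(a\otimes\xi)=\phi_f(a)\xi$, $m_{f,1_w}(\xi\otimes b)=\xi b$ for $f\in P(w,x)$.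 Let $\mathcal K(X_f)$ be the closed span of the rank one operators $\theta_{\xi,\eta}(\zeta)=\xi\langle\eta,\zeta\rangle$. For $f\le g$ let $l_f^g(T)=m_{f,f^{-1}g}(T\otimes I)m_{f,f^{-1}g}^*$, and $l_f^g=0$ if $f\not\le g$. Assume that $X$ is compactly aligned: $l_f^{f\vee g}(S)\,l_g^{f\vee g}(T)\in\mathcal K(X_{f\vee g})$ for all $S\in\mathcal K(X_f)$, $T\in\mathcal K(X_g)$ whenever $f\vee g$ exists. Let $\psi=\{\psi_f:X_f\to B\}_{f\in P(-,-)}$ be a Toeplitz representation of $X$ in a C*-algebra $B$: linear maps such that each $\psi_{1_x}$ is a $*$-homomorphism, $\psi_g(\beta)\psi_f(\xi)=\psi_{gf}(m_{g,f}(\beta\otimes\xi))$ when $s(g)=t(f)$, and $\psi_f(\eta)^*\psi_f(\xi)=\psi_{1_{s(f)}}(\langle\eta,\xi\rangle)$. Let $\psi^{(f)}:\mathcal K(X_f)\to B$ be the $*$-homomorphism with $\psi^{(f)}(\theta_{\xi,\eta})=\psi_f(\xi)\psi_f(\eta)^*$. For $k\in P(x,x)$ let $I_k=A_x$ if $k=1_x$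 and $I_k=\bigcap_{1_x<f\le k}\ker\phi_f$ otherwise. For $g\in P(x,y)$ let $\widetilde X_g=\bigoplus_{h\in P(x,y),\,h\le g}X_hI_{h^{-1}g}$ (Hilbert module direct sum), and for $f\in P(-,y)$, $T\in\mathcal L(X_f)$, let $(\widetilde l_f^{\,g}(T)\xi)(h)=l_f^h(T)(\xi(h))$ for $\xi\in\widetilde X_g$. Call $\psi$ Cuntz–Pimsner covariant if $\sum_{f\in F}\psi^{(f)}(T_f)=0$ for every object $y$, every finite $F\subseteq P(-,y)$ and all $T_f\in\mathcal K(X_f)$ ($f\in F$) such that $\sum_{f\in F}\widetilde l_f^{\,g}(T_f)=0$ for large $g$, that is: for every $k\in P(-,y)$ there is $h\ge k$ such that the equality holds for all $g\in P(-,y)$ with $g\ge h$. Assume that for every object $y$ any two elements of $P(-,y)$ have a least upper bound in $P(-,y)$, and that $\phi_f$ is injective for every $f\in P(-,-)$. Then: (1) If $\psi$ is Cuntz–Pimsner covariant, then $\psi^{(f)}(\phi_f(a))=\psi_{1_{t(f)}}(a)$ for every $f\in P(-,-)$ and every $a\in A_{t(f)}$ with $\phi_f(a)\in\mathcal K(X_f)$.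 (2) If $\phi_f(A_{t(f)})\subseteq\mathcal K(X_f)$ and $\psi^{(f)}(\phi_f(a))=\psi_{1_{t(f)}}(a)$ for every $f\in P(-,-)$ and $a\in A_{t(f)}$, then $\psi$ is Cuntz–Pimsner covariant. -/

import Mathlib

open CategoryTheory
open scoped RightActions

universe u v w₁ w₂ w₃

namespace PSys

/-! ### Hilbert modules and C*-correspondences -/

/-- A right Hilbert `B`-module (completeness is required separately): a complex normed space with a
right action `x <• b` of `B` and a `B`-valued inner product `inner B x y`, linear in `y`, inducing
the norm. The usual laws of the right action, such as `(x + y) <• b = x <• b + y <• b`, follow from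
the nondegeneracy of the inner product. -/
class HilbertModule (B X : Type*) [NonUnitalCStarAlgebra B] [PartialOrder B] [StarOrderedRing B]
    [NormedAddCommGroup X] [NormedSpace ℂ X] extends SMul Bᵐᵒᵖ X, Inner B X where
  inner_add_right (x y z : X) : inner x (y + z) = inner x y + inner x z
  inner_smul_right (c : ℂ) (x y : X) : inner x (c • y) = c • inner x y
  inner_rsmul (x y : X) (b : B) : inner x (y <• b) = inner x y * b
  star_inner (x y : X) : star (inner x y) = inner y x
  inner_self_nonneg (x : X) : 0 ≤ inner x x
  norm_sq (x : X) : ‖x‖ ^ 2 = ‖inner x x‖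

namespace HilbertModule

variable {B X : Type*} [NonUnitalCStarAlgebra B] [PartialOrder B] [StarOrderedRing B]
  [NormedAddCommGroup X] [NormedSpace ℂ X] [HilbertModule B X]

theorem inner_add_left (x y z : X) : inner B (x + y) z = inner B x z + inner B y z := by
  rw [← star_inner, inner_add_right, star_add, star_inner, star_inner]

theorem inner_smul_left (c : ℂ) (x y : X) : inner B (c • x) y = star c • inner B x y := by
  rw [← star_inner, inner_smul_right, star_smul, star_inner]

theorem inner_rsmul_left (x y : X) (b : B) : inner B (x <• b) y = star b * inner B x y := by
  rw [← star_inner, inner_rsmul, star_mul, star_inner]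

variable (B) in
/-- The inner product as a linear map in its second variable. -/
def innerL (x : X) : X →ₗ[ℂ] B where
  toFun y := inner B x y
  map_add' := inner_add_right x
  map_smul' c y := inner_smul_right c x y

theorem inner_zero_right (x : X) : inner B x 0 = 0 := (innerL B x).map_zero

theorem inner_sub_right (x y z : X) : inner B x (y - z) = inner B x y - inner B x z :=
  (innerL B x).map_sub y z

theorem inner_sub_left (x y z : X) : inner B (x - y) z = inner B x z - inner B y z := by
  rw [← star_inner, inner_sub_right, star_sub, star_inner, star_inner]

variable (B) in
theorem eq_of_inner {x y : X} (h : ∀ z, inner B z x = inner B z y) : x = y := by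
  have h0 : inner B (x - y) (x - y) = 0 := by rw [inner_sub_right, h, sub_self]
  have h1 := norm_sq (B := B) (x - y)
  rw [h0, norm_zero] at h1
  exact sub_eq_zero.1 (norm_eq_zero.1 (pow_eq_zero_iff two_ne_zero |>.1 h1))

theorem add_rsmul (x y : X) (b : B) : (x + y) <• b = x <• b + y <• b :=
  eq_of_inner B fun z => by simp only [inner_rsmul, inner_add_right, add_mul]

theorem smul_rsmul (c : ℂ) (x : X) (b : B) : (c • x) <• b = c • (x <• b) :=
  eq_of_inner B fun z => by simp only [inner_rsmul, inner_smul_right, smul_mul_assoc]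

theorem rsmul_add (x : X) (b c : B) : x <• (b + c) = x <• b + x <• c :=
  eq_of_inner B fun z => by simp only [inner_rsmul, inner_add_right, mul_add]

theorem rsmul_smul (x : X) (c : ℂ) (b : B) : x <• (c • b) = c • (x <• b) :=
  eq_of_inner B fun z => by simp only [inner_rsmul, inner_smul_right, mul_smul_comm]

variable (B) in
theorem norm_inner_le (x y : X) : ‖inner B x y‖ ≤ ‖x‖ * ‖y‖ := by
  rcases eq_or_ne x 0 with rfl | hx
  · rw [← star_inner, inner_zero_right]; simp
  set a : B := inner B x y with ha
  have hxn : 0 < ‖x‖ := norm_pos_iff.2 hx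
  have e1 : inner B ((x <• a) - (((‖x‖ ^ 2 : ℝ) : ℂ) • y)) ((x <• a) - (((‖x‖ ^ 2 : ℝ) : ℂ) • y)) =
      star a * inner B x x * a - (‖x‖ ^ 2) • (star a * a) - (‖x‖ ^ 2) • (star a * a)
        + (‖x‖ ^ 2) • ((‖x‖ ^ 2) • inner B y y) := by
    have hs : inner B y x = star a := by rw [ha, star_inner]
    simp only [inner_sub_left, inner_sub_right, inner_rsmul, inner_rsmul_left, inner_smul_right,
      inner_smul_left, ← ha, hs, Complex.star_def, Complex.conj_ofReal]
    simp only [Complex.coe_smul, sub_mul, smul_mul_assoc, smul_sub]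
    abel
  have h1 : star a * inner B x x * a ≤ (‖x‖ ^ 2) • (star a * a) := by
    rw [norm_sq (B := B)]
    exact CStarAlgebra.star_left_conjugate_le_norm_smul (hb := by
      rw [IsSelfAdjoint, star_inner])
  have h2 := e1 ▸ inner_self_nonneg (B := B) ((x <• a) - (((‖x‖ ^ 2 : ℝ) : ℂ) • y))
  have h3 : (‖x‖ ^ 2) • (star a * a) ≤ (‖x‖ ^ 2) • ((‖x‖ ^ 2) • inner B y y) := by
    have h4 : (0 : B) ≤ (‖x‖ ^ 2) • (star a * a) - (‖x‖ ^ 2) • (star a * a)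
        - (‖x‖ ^ 2) • (star a * a) + (‖x‖ ^ 2) • ((‖x‖ ^ 2) • inner B y y) := by
      refine h2.trans ?_
      gcongr
    rw [sub_self, zero_sub, neg_add_eq_sub, sub_nonneg] at h4
    exact h4
  have h5 : star a * a ≤ (‖x‖ ^ 2) • inner B y y :=
    (smul_le_smul_iff_of_pos_left (by positivity)).1 h3
  have h6 := CStarAlgebra.norm_le_norm_of_nonneg_of_le (star_mul_self_nonneg a) h5
  rw [CStarRing.norm_star_mul_self, norm_smul, ← norm_sq (B := B), Real.norm_of_nonneg (by positivity)]
    at h6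
  nlinarith [norm_nonneg a, mul_nonneg (norm_nonneg x) (norm_nonneg y)]

theorem norm_rsmul_le (x : X) (b : B) : ‖x <• b‖ ≤ ‖x‖ * ‖b‖ := by
  have h := norm_sq (B := B) (x <• b)
  rw [inner_rsmul, inner_rsmul_left] at h
  have h1 : ‖star b * inner B x x * b‖ ≤ ‖b‖ * ‖x‖ ^ 2 * ‖b‖ := by
    refine (norm_mul_le _ _).trans ?_
    gcongr
    refine (norm_mul_le _ _).trans ?_
    rw [norm_star, norm_sq (B := B)]
  nlinarith [norm_nonneg (x <• b), mul_nonneg (norm_nonneg x) (norm_nonneg b)]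

variable (B) in
/-- The rank one operator `θ_{ξ, η} ζ = ξ ⟨η, ζ⟩`. -/
noncomputable def theta (ξ η : X) : X →L[ℂ] X :=
  LinearMap.mkContinuous
    { toFun := fun ζ => ξ <• inner B η ζ
      map_add' := fun a b => by rw [inner_add_right, rsmul_add]
      map_smul' := fun c a => by rw [inner_smul_right, rsmul_smul]; rfl }
    (‖ξ‖ * ‖η‖) fun ζ => by
      refine (norm_rsmul_le _ _).trans ?_
      rw [mul_assoc]
      exact mul_le_mul_of_nonneg_left (norm_inner_le B η ζ) (norm_nonneg _)

theorem theta_apply (ξ η ζ : X) : theta B ξ η ζ = ξ <• inner B η ζ := rfl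

variable (B X) in
/-- `𝓛(X)`, the adjointable operators on `X`. -/
def adjointable : Submodule ℂ (X →L[ℂ] X) where
  carrier := {T | ∃ S : X →L[ℂ] X, ∀ x y, inner B (T x) y = inner B x (S y)}
  add_mem' := by
    rintro T T' ⟨S, h⟩ ⟨S', h'⟩
    exact ⟨S + S', fun x y => by
      simp only [add_apply, inner_add_left, inner_add_right, h, h']⟩
  zero_mem' := ⟨0, fun x y => by
    simp only [zero_apply]
    rw [← star_inner, inner_zero_right, inner_zero_right, star_zero]⟩
  smul_mem' := by
    rintro c T ⟨S, h⟩
    exact ⟨star c • S, fun x y => by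
      simp only [smul_apply, inner_smul_left, inner_smul_right, h]⟩

variable (B X) in
/-- `𝓚(X)`, the compact operators on `X`: the closed linear span of the rank one operators. -/
noncomputable def compacts : Submodule ℂ (X →L[ℂ] X) :=
  (Submodule.span ℂ {T | ∃ ξ η : X, T = theta B ξ η}).topologicalClosure

theorem theta_mem_compacts (ξ η : X) : theta B ξ η ∈ compacts B X :=
  Submodule.le_topologicalClosure _ (Submodule.subset_span ⟨ξ, η, rfl⟩)

end HilbertModule

open HilbertModule

/-- The left action `φ : A → 𝓛(X)` (a nondegenerate `*`-homomorphism) making the Hilbert `B`-module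
`X` into an `A`-`B` C*-correspondence. -/
structure LeftAction (A B X : Type*) [NonUnitalCStarAlgebra A]
    [NonUnitalCStarAlgebra B] [PartialOrder B] [StarOrderedRing B]
    [NormedAddCommGroup X] [NormedSpace ℂ X] [HilbertModule B X] where
  φ : A →ₙₐ[ℂ] (X →L[ℂ] X)
  adjoint (a : A) (ξ η : X) : inner B (φ a ξ) η = inner B ξ (φ (star a) η)
  nondegenerate : (Submodule.span ℂ {ζ | ∃ a ξ, ζ = φ a ξ}).topologicalClosure = ⊤

namespace HilbertModule

/-! ### Well-definedness of the induced maps -/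

theorem le_of_pow_two_pow_le {x y D : ℝ} (hy : 0 ≤ y)
    (h : ∀ k : ℕ, x ^ 2 ^ k ≤ D * y ^ 2 ^ k) : x ≤ y := by
  by_contra! hlt
  rcases hy.eq_or_lt with rfl | hy
  · have := h 0
    simp at this
    linarith
  · have h1 : 1 < x / y := (one_lt_div hy).2 hlt
    obtain ⟨n, hn⟩ := pow_unbounded_of_one_lt D h1
    have h2 : (x / y) ^ n ≤ (x / y) ^ 2 ^ n := pow_le_pow_right₀ h1.le Nat.lt_two_pow_self.le
    rw [div_pow x y (2 ^ n)] at h2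
    have h3 : x ^ 2 ^ n / y ^ 2 ^ n ≤ D := (div_le_iff₀ (by positivity)).2 (h n)
    linarith

section Tensor

open TensorProduct

variable {B C E F W : Type*} [NonUnitalCStarAlgebra B] [PartialOrder B] [StarOrderedRing B]
  [NonUnitalCStarAlgebra C] [PartialOrder C] [StarOrderedRing C]
  [NormedAddCommGroup E] [NormedSpace ℂ E] [HilbertModule C E]
  [NormedAddCommGroup F] [NormedSpace ℂ F] [HilbertModule B F]
  [NormedAddCommGroup W] [NormedSpace ℂ W] [HilbertModule B W]

/-- The map `ξ ⊗ η ↦ m (T ξ) η` on the algebraic tensor product. -/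
noncomputable def tmap (m : E →ₗ[ℂ] F →ₗ[ℂ] W) (T : E →L[ℂ] E) : E ⊗[ℂ] F →ₗ[ℂ] W :=
  TensorProduct.lift (m ∘ₗ (T : E →ₗ[ℂ] E))

theorem tmap_tmul (m : E →ₗ[ℂ] F →ₗ[ℂ] W) (T : E →L[ℂ] E) (ξ : E) (η : F) :
    tmap m T (ξ ⊗ₜ η) = m (T ξ) η := by simp [tmap]

variable {m : E →ₗ[ℂ] F →ₗ[ℂ] W} {L : LeftAction C B F}

theorem inner_tmap
    (hm : ∀ ξ ξ' η η', inner B (m ξ η) (m ξ' η') = inner B η (L.φ (inner C ξ ξ') η'))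
    {T S R : E →L[ℂ] E} (hT : ∀ x y, inner C (T x) y = inner C x (S y)) (u v : E ⊗[ℂ] F) :
    inner B (tmap m T u) (tmap m R v) = inner B (tmap m 1 u) (tmap m (S * R) v) := by
  induction u using TensorProduct.induction_on with
  | zero =>
    simp only [map_zero]
    rw [← star_inner, inner_zero_right, ← star_inner, inner_zero_right]
  | add u u' h h' => simp only [map_add, inner_add_left, h, h']
  | tmul ξ η =>
    induction v using TensorProduct.induction_on with
    | zero => simp only [map_zero]; rw [inner_zero_right, inner_zero_right]
    | add u u' h h' => simp only [map_add, inner_add_right, h, h']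
    | tmul ξ' η' =>
      simp only [tmap_tmul, hm, hT]
      rfl

theorem exists_norm_mul_le
    (hm : ∀ ξ ξ' η η', inner B (m ξ η) (m ξ' η') = inner B η (L.φ (inner C ξ ξ') η')) (η : F) :
    ∃ K : ℝ, 0 ≤ K ∧ ∀ ζ, ‖m ζ η‖ ≤ K * ‖ζ‖ := by
  let p : C →ₚ[ℂ] B := PositiveLinearMap.mk₀
    { toFun := fun c => inner B η (L.φ c η)
      map_add' := fun a b => by simp only [map_add, add_apply, inner_add_right]
      map_smul' := fun a b => by
        simp only [map_smul, smul_apply, inner_smul_right]; rfl } <| by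
      intro c hc
      obtain ⟨d, rfl⟩ := CStarAlgebra.nonneg_iff_eq_star_mul_self.1 hc
      have := L.adjoint d η (L.φ d η)
      simp only [LinearMap.coe_mk, AddHom.coe_mk, map_mul]
      change 0 ≤ inner B η (L.φ (star d) (L.φ d η))
      rw [← this]
      exact inner_self_nonneg _
  obtain ⟨K, hK⟩ := p.exists_norm_apply_le
  refine ⟨√K, Real.sqrt_nonneg _, fun ζ => ?_⟩
  have h1 := hK (inner C ζ ζ)
  have h2 : p (inner C ζ ζ) = inner B (m ζ η) (m ζ η) := (hm ζ ζ η η).symm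
  rw [h2, ← norm_sq, ← norm_sq] at h1
  have h3 : ‖m ζ η‖ ^ 2 ≤ (√K * ‖ζ‖) ^ 2 := by
    rw [mul_pow, Real.sq_sqrt K.coe_nonneg]; exact h1
  exact (sq_le_sq₀ (norm_nonneg _) (by positivity)).1 h3

theorem exists_norm_tmap_le
    (hm : ∀ ξ ξ' η η', inner B (m ξ η) (m ξ' η') = inner B η (L.φ (inner C ξ ξ') η'))
    (u : E ⊗[ℂ] F) : ∃ K : ℝ, 0 ≤ K ∧ ∀ T : E →L[ℂ] E, ‖tmap m T u‖ ≤ K * ‖T‖ := by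
  induction u using TensorProduct.induction_on with
  | zero => exact ⟨0, le_rfl, fun T => by simp⟩
  | add u u' h h' =>
    obtain ⟨K, hK, h⟩ := h
    obtain ⟨K', hK', h'⟩ := h'
    refine ⟨K + K', by positivity, fun T => ?_⟩
    rw [map_add, add_mul]
    exact (norm_add_le _ _).trans (add_le_add (h T) (h' T))
  | tmul ξ η =>
    obtain ⟨K, hK, h⟩ := exists_norm_mul_le hm η
    refine ⟨K * ‖ξ‖, by positivity, fun T => ?_⟩
    rw [tmap_tmul]
    calc _ ≤ K * ‖T ξ‖ := h _
      _ ≤ K * (‖T‖ * ‖ξ‖) := by gcongr; exact T.le_opNorm ξ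
      _ = _ := by ring

theorem norm_tmap_le
    (hm : ∀ ξ ξ' η η', inner B (m ξ η) (m ξ' η') = inner B η (L.φ (inner C ξ ξ') η'))
    {T S : E →L[ℂ] E} (hT : ∀ x y, inner C (T x) y = inner C x (S y)) (u : E ⊗[ℂ] F) :
    ‖tmap m T u‖ ^ 2 ≤ ‖S * T‖ * ‖tmap m 1 u‖ ^ 2 := by
  have hT' : ∀ x y, inner C (S x) y = inner C x (T y) := fun x y => by
    rw [← star_inner, ← hT, star_inner]
  set H := S * T with hH
  have hHs : ∀ n : ℕ, ∀ x y, inner C ((H ^ n) x) y = inner C x ((H ^ n) y) := by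
    intro n
    induction n with
    | zero => intro x y; simp
    | succ n ih =>
      intro x y
      have e1 : (H ^ (n + 1)) x = (H ^ n) (S (T x)) := by rw [pow_succ]; rfl
      have e2 : (H ^ (n + 1)) y = S (T ((H ^ n) y)) := by rw [pow_succ']; rfl
      rw [e1, e2, ih, hT', hT]
  obtain ⟨K, hK0, hK⟩ := exists_norm_tmap_le hm u
  set a : ℕ → ℝ := fun n => ‖tmap m (H ^ n) u‖ with ha
  have ha0 : ∀ n, 0 ≤ a n := fun n => norm_nonneg _
  have hsq : ∀ n, a n ^ 2 ≤ a 0 * a (2 * n) := fun n => by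
    simp only [ha]
    rw [norm_sq (B := B), inner_tmap hm (hHs n), pow_zero, two_mul, pow_add]
    exact norm_inner_le B _ _
  have hind : ∀ k : ℕ, a 1 ^ 2 ^ k * a 0 ≤ a 0 ^ 2 ^ k * a (2 ^ k) := by
    intro k
    induction k with
    | zero => simp [mul_comm]
    | succ k ih =>
      rcases (ha0 0).eq_or_lt with h | h
      · rw [← h]; simp
      · have h1 : (a 1 ^ 2 ^ k * a 0) ^ 2 ≤ (a 0 ^ 2 ^ k * a (2 ^ k)) ^ 2 := by
          have := ha0 1
          gcongr
        have h2 := hsq (2 ^ k)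
        rw [← pow_succ'] at h2
        have h3 : (a 0 ^ 2 ^ k * a (2 ^ k)) ^ 2 ≤ (a 0 ^ 2 ^ k) ^ 2 * (a 0 * a (2 ^ (k + 1))) := by
          rw [mul_pow]; gcongr
        have h4 := h1.trans h3
        rw [pow_succ 2 k, pow_mul, pow_mul, ← pow_succ]
        have h5 : a 0 * ((a 1 ^ 2 ^ k) ^ 2 * a 0) ≤ a 0 * ((a 0 ^ 2 ^ k) ^ 2 * a (2 ^ (k + 1))) := by
          nlinarith
        exact le_of_mul_le_mul_left h5 h
  have hone : a 1 ≤ a 0 * ‖H‖ := by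
    rcases (ha0 0).eq_or_lt with h | h
    · have := hsq 1
      rw [← h, zero_mul] at this
      rw [← h, zero_mul]
      nlinarith [ha0 1]
    · refine le_of_pow_two_pow_le (D := K / a 0) (by positivity) fun k => ?_
      rw [div_mul_eq_mul_div, le_div_iff₀ h, mul_pow]
      refine (hind k).trans ?_
      calc a 0 ^ 2 ^ k * a (2 ^ k) ≤ a 0 ^ 2 ^ k * (K * ‖H‖ ^ 2 ^ k) := by
            gcongr
            refine (hK _).trans ?_
            gcongr
            exact norm_pow_le' H (by positivity)
        _ = _ := by ring
  have h1 : ‖tmap m T u‖ ^ 2 ≤ a 0 * a 1 := by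
    rw [norm_sq (B := B), inner_tmap hm hT]
    simp only [ha, pow_zero, pow_one]
    exact norm_inner_le B _ _
  have h2 : ‖tmap m 1 u‖ = a 0 := by simp [ha]
  rw [h2]
  nlinarith [ha0 0]

end Tensor

end HilbertModule

namespace HilbertModule

section Continuity

variable {B W : Type*} [NonUnitalCStarAlgebra B] [PartialOrder B] [StarOrderedRing B]
  [NormedAddCommGroup W] [NormedSpace ℂ W] [HilbertModule B W]

theorem continuous_inner_right (x : W) : Continuous fun y : W => inner B x y :=
  AddMonoidHomClass.continuous_of_bound (innerL B x) ‖x‖ (norm_inner_le B x)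

theorem continuous_inner_left (y : W) : Continuous fun x : W => inner B x y := by
  have := (continuous_inner_right (B := B) y).star
  simpa only [star_inner] using this

end Continuity

section Dense

open TensorProduct

variable {E F W : Type*}
  [NormedAddCommGroup E] [NormedSpace ℂ E] [NormedAddCommGroup F] [NormedSpace ℂ F]
  [NormedAddCommGroup W] [NormedSpace ℂ W] {m : E →ₗ[ℂ] F →ₗ[ℂ] W}

theorem denseRange_tmap
    (htot : (Submodule.span ℂ {ζ | ∃ ξ η, ζ = m ξ η}).topologicalClosure = ⊤) :
    DenseRange (tmap m (1 : E →L[ℂ] E)) := by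
  have h1 : Submodule.span ℂ {ζ | ∃ ξ η, ζ = m ξ η} ≤ LinearMap.range (tmap m (1 : E →L[ℂ] E)) := by
    rw [Submodule.span_le]
    rintro _ ⟨ξ, η, rfl⟩
    exact ⟨ξ ⊗ₜ η, by rw [tmap_tmul]; rfl⟩
  have h2 := (Submodule.dense_iff_topologicalClosure_eq_top.2 htot)
  exact h2.mono h1

end Dense

section Lift

open TensorProduct

variable {B C E F W : Type*} [NonUnitalCStarAlgebra B] [PartialOrder B] [StarOrderedRing B]
  [NonUnitalCStarAlgebra C] [PartialOrder C] [StarOrderedRing C]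
  [NormedAddCommGroup E] [NormedSpace ℂ E] [HilbertModule C E]
  [NormedAddCommGroup F] [NormedSpace ℂ F] [HilbertModule B F]
  [NormedAddCommGroup W] [NormedSpace ℂ W] [CompleteSpace W] [HilbertModule B W]

/-- The operator `m (T ⊗ I) m⁻¹` on `W`, that is, the continuous extension of
`m (ξ ⊗ η) ↦ m (T ξ ⊗ η)`, when `m` induces a unitary from the completed tensor product `E ⊗ F` onto
`W` and `T` is adjointable. -/
noncomputable def lift (m : E →ₗ[ℂ] F →ₗ[ℂ] W) (T : E →L[ℂ] E) : W →L[ℂ] W :=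
  (tmap m T).extendOfNorm (tmap m 1)

variable {m : E →ₗ[ℂ] F →ₗ[ℂ] W} {L : LeftAction C B F}

theorem lift_tmap
    (hm : ∀ ξ ξ' η η', inner B (m ξ η) (m ξ' η') = inner B η (L.φ (inner C ξ ξ') η'))
    (htot : (Submodule.span ℂ {ζ | ∃ ξ η, ζ = m ξ η}).topologicalClosure = ⊤)
    {T : E →L[ℂ] E} (hT : T ∈ adjointable C E) (u : E ⊗[ℂ] F) :
    lift m T (tmap m 1 u) = tmap m T u := by
  obtain ⟨S, hS⟩ := hT
  refine LinearMap.extendOfNorm_eq (denseRange_tmap htot) ⟨√‖S * T‖, fun u => ?_⟩ u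
  have h := norm_tmap_le hm hS u
  have h3 : ‖tmap m T u‖ ^ 2 ≤ (√‖S * T‖ * ‖tmap m 1 u‖) ^ 2 := by
    rw [mul_pow, Real.sq_sqrt (norm_nonneg _)]; exact h
  exact (sq_le_sq₀ (norm_nonneg _) (by positivity)).1 h3

theorem lift_mul
    (hm : ∀ ξ ξ' η η', inner B (m ξ η) (m ξ' η') = inner B η (L.φ (inner C ξ ξ') η'))
    (htot : (Submodule.span ℂ {ζ | ∃ ξ η, ζ = m ξ η}).topologicalClosure = ⊤)
    {T : E →L[ℂ] E} (hT : T ∈ adjointable C E) (ξ : E) (η : F) :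
    lift m T (m ξ η) = m (T ξ) η := by
  have := lift_tmap hm htot hT (ξ ⊗ₜ η)
  rw [tmap_tmul, tmap_tmul] at this
  exact this

theorem lift_mem
    (hm : ∀ ξ ξ' η η', inner B (m ξ η) (m ξ' η') = inner B η (L.φ (inner C ξ ξ') η'))
    (htot : (Submodule.span ℂ {ζ | ∃ ξ η, ζ = m ξ η}).topologicalClosure = ⊤)
    {T : E →L[ℂ] E} (hT : T ∈ adjointable C E) : lift m T ∈ adjointable B W := by
  have hT0 := hT
  obtain ⟨S, hS⟩ := hT
  have hS' : S ∈ adjointable C E := ⟨T, fun x y => by rw [← star_inner, ← hS, star_inner]⟩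
  refine ⟨lift m S, fun x y => ?_⟩
  have hd := denseRange_tmap htot
  refine hd.induction_on (p := fun x => inner B (lift m T x) y = inner B x (lift m S y)) x
    (isClosed_eq ((continuous_inner_left y).comp (lift m T).continuous)
      (continuous_inner_left _)) fun u => ?_
  refine hd.induction_on (p := fun y => inner B (lift m T (tmap m 1 u)) y =
      inner B (tmap m 1 u) (lift m S y)) y
    (isClosed_eq (continuous_inner_right _)
      ((continuous_inner_right _).comp (lift m S).continuous)) fun v => ?_
  rw [lift_tmap hm htot hT0, lift_tmap hm htot hS', inner_tmap hm hS, mul_one]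

end Lift

section Compact

variable {B X : Type*} [NonUnitalCStarAlgebra B] [PartialOrder B] [StarOrderedRing B]
  [NormedAddCommGroup X] [NormedSpace ℂ X] [HilbertModule B X]

theorem inner_theta (ξ η x y : X) :
    inner B (theta B ξ η x) y = inner B x (theta B η ξ y) := by
  rw [theta_apply, theta_apply, inner_rsmul_left, inner_rsmul, star_inner]

theorem norm_le_of_adjoint {T S : X →L[ℂ] X} (h : ∀ x y, inner B (T x) y = inner B x (S y)) :
    ‖S‖ ≤ ‖T‖ := by
  refine S.opNorm_le_bound (norm_nonneg _) fun x => ?_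
  have h1 : ‖S x‖ ^ 2 ≤ ‖T‖ * ‖S x‖ * ‖x‖ := by
    rw [norm_sq (B := B), ← h, ← star_inner, norm_star]
    refine (norm_inner_le B _ _).trans ?_
    rw [mul_comm]
    gcongr
    exact T.le_opNorm _
  rcases (norm_nonneg (S x)).eq_or_lt with h0 | h0
  · rw [← h0]; positivity
  · nlinarith

theorem theta_mem_adjointable (ξ η : X) : theta B ξ η ∈ adjointable B X :=
  ⟨theta B η ξ, inner_theta ξ η⟩

theorem isClosed_adjointable [CompleteSpace X] : IsClosed (adjointable B X : Set (X →L[ℂ] X)) := by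
  refine IsSeqClosed.isClosed fun T T₀ hT hlim => ?_
  choose S hS using hT
  have hc : CauchySeq S := by
    rw [Metric.cauchySeq_iff']
    intro ε hε
    obtain ⟨N, hN⟩ := Metric.cauchySeq_iff'.1 hlim.cauchySeq ε hε
    refine ⟨N, fun n hn => ?_⟩
    refine lt_of_le_of_lt ?_ (hN n hn)
    rw [dist_eq_norm, dist_eq_norm]
    refine norm_le_of_adjoint (B := B) fun x y => ?_
    simp only [sub_apply, inner_sub_left, inner_sub_right, hS]
  obtain ⟨S₀, hS₀⟩ := cauchySeq_tendsto_of_complete hc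
  refine ⟨S₀, fun x y => ?_⟩
  have h1 : Filter.Tendsto (fun n => inner B (T n x) y) Filter.atTop (nhds (inner B (T₀ x) y)) := by
    refine ((continuous_inner_left (B := B) y).tendsto _).comp ?_
    exact ((ContinuousLinearMap.apply ℂ X x).continuous.tendsto _).comp hlim
  have h2 : Filter.Tendsto (fun n => inner B x (S n y)) Filter.atTop (nhds (inner B x (S₀ y))) := by
    refine ((continuous_inner_right (B := B) x).tendsto _).comp ?_
    exact ((ContinuousLinearMap.apply ℂ X y).continuous.tendsto _).comp hS₀
  simp only [hS] at h1
  exact tendsto_nhds_unique h1 h2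

theorem compacts_le_adjointable [CompleteSpace X] : compacts B X ≤ adjointable B X :=
  Submodule.topologicalClosure_minimal _ (Submodule.span_le.2 (by
    rintro _ ⟨ξ, η, rfl⟩
    exact theta_mem_adjointable ξ η)) isClosed_adjointable

variable {D : Type*} [NonUnitalCStarAlgebra D]

/-- The linear relation spanned by the pairs `(θ_{ξ, η}, ψ(ξ) ψ(η)^*)`. -/
def compactGraph (B : Type*) {X D : Type*} [NonUnitalCStarAlgebra B] [PartialOrder B]
    [StarOrderedRing B] [NormedAddCommGroup X] [NormedSpace ℂ X] [HilbertModule B X]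
    [NonUnitalCStarAlgebra D] (ψ : X →ₗ[ℂ] D) : Submodule ℂ ((X →L[ℂ] X) × D) :=
  Submodule.span ℂ {p | ∃ ξ η, p = (theta B ξ η, ψ ξ * star (ψ η))}

variable {ψ : X →ₗ[ℂ] D} {π : B →⋆ₙₐ[ℂ] D}

theorem compactGraph_apply (h1 : ∀ ξ η, star (ψ ξ) * ψ η = π (inner B ξ η))
    (h2 : ∀ ξ b, ψ ξ * π b = ψ (ξ <• b)) {p : (X →L[ℂ] X) × D} (hp : p ∈ compactGraph B ψ) (ζ : X) :
    p.2 * ψ ζ = ψ (p.1 ζ) := by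
  induction hp using Submodule.span_induction with
  | mem p hp =>
    obtain ⟨ξ, η, rfl⟩ := hp
    rw [mul_assoc, h1, h2, theta_apply]
  | zero => simp
  | add p q _ _ hp hq => simp only [Prod.fst_add, Prod.snd_add, add_mul, add_apply, map_add, hp, hq]
  | smul c p _ hp =>
    simp only [Prod.smul_fst, Prod.smul_snd, smul_mul_assoc, smul_apply, map_smul, hp]

theorem compactGraph_star {p : (X →L[ℂ] X) × D} (hp : p ∈ compactGraph B ψ) :
    ∃ S, (S, star p.2) ∈ compactGraph B ψ ∧ ∀ x y, inner B (p.1 x) y = inner B x (S y) := by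
  induction hp using Submodule.span_induction with
  | mem p hp =>
    obtain ⟨ξ, η, rfl⟩ := hp
    refine ⟨theta B η ξ, Submodule.subset_span ⟨η, ξ, ?_⟩, inner_theta ξ η⟩
    rw [star_mul, star_star]
  | zero =>
    refine ⟨0, by rw [Prod.snd_zero, star_zero]; exact (compactGraph B ψ).zero_mem, fun x y => ?_⟩
    simp only [Prod.fst_zero, zero_apply]
    rw [← star_inner, inner_zero_right, inner_zero_right, star_zero]
  | add p q _ _ hp hq =>
    obtain ⟨S, hS, h⟩ := hp
    obtain ⟨S', hS', h'⟩ := hq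
    refine ⟨S + S', ?_, fun x y => ?_⟩
    · rw [Prod.snd_add, star_add]
      exact (compactGraph B ψ).add_mem hS hS'
    · simp only [Prod.fst_add, add_apply, inner_add_left, inner_add_right, h, h']
  | smul c p _ hp =>
    obtain ⟨S, hS, h⟩ := hp
    refine ⟨star c • S, ?_, fun x y => ?_⟩
    · rw [Prod.smul_snd, star_smul]
      exact (compactGraph B ψ).smul_mem (star c) hS
    · simp only [Prod.smul_fst, smul_apply, inner_smul_left, inner_smul_right, h]

theorem compactGraph_mul (h1 : ∀ ξ η, star (ψ ξ) * ψ η = π (inner B ξ η))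
    (h2 : ∀ ξ b, ψ ξ * π b = ψ (ξ <• b)) {p q : (X →L[ℂ] X) × D} (hp : p ∈ compactGraph B ψ)
    (hq : q ∈ compactGraph B ψ) : p * q ∈ compactGraph B ψ := by
  induction hq using Submodule.span_induction with
  | mem q hq =>
    obtain ⟨ξ, η, rfl⟩ := hq
    refine Submodule.subset_span ⟨p.1 ξ, η, ?_⟩
    obtain ⟨S, -, hS⟩ := compactGraph_star hp
    refine Prod.ext ?_ ?_
    · ext ζ
      change p.1 (theta B ξ η ζ) = theta B (p.1 ξ) η ζ
      rw [theta_apply, theta_apply]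
      refine eq_of_inner B fun z => ?_
      have hS' : ∀ x, inner B z (p.1 x) = inner B (S z) x := fun x => by
        rw [← star_inner, hS, star_inner]
      rw [hS', inner_rsmul, inner_rsmul, hS']
    · change p.2 * (ψ ξ * star (ψ η)) = _
      rw [← mul_assoc, compactGraph_apply h1 h2 hp]
  | zero => rw [mul_zero]; exact (compactGraph B ψ).zero_mem
  | add q r _ _ hq hr => rw [mul_add]; exact (compactGraph B ψ).add_mem hq hr
  | smul c q _ hq => rw [mul_smul_comm]; exact (compactGraph B ψ).smul_mem c hq

theorem norm_toeplitz_le (h1 : ∀ ξ η, star (ψ ξ) * ψ η = π (inner B ξ η)) (ξ : X) :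
    ‖ψ ξ‖ ≤ ‖ξ‖ := by
  have h : ‖ψ ξ‖ * ‖ψ ξ‖ ≤ ‖ξ‖ ^ 2 := by
    rw [← CStarRing.norm_star_mul_self, h1, norm_sq (B := B)]
    exact NonUnitalStarAlgHom.norm_apply_le π _
  nlinarith [norm_nonneg (ψ ξ), norm_nonneg ξ]

theorem compactGraph_bound (h1 : ∀ ξ η, star (ψ ξ) * ψ η = π (inner B ξ η))
    (h2 : ∀ ξ b, ψ ξ * π b = ψ (ξ <• b)) {p : (X →L[ℂ] X) × D} (hp : p ∈ compactGraph B ψ) :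
    ∃ K : ℝ, 0 ≤ K ∧ ∀ q ∈ compactGraph B ψ, ∀ n : ℕ,
      ‖((q.2 : Unitization ℂ D) ^ n) * (p.2 : Unitization ℂ D)‖ ≤ K * ‖q.1‖ ^ n := by
  induction hp using Submodule.span_induction with
  | mem p hp =>
    obtain ⟨ξ, η, rfl⟩ := hp
    refine ⟨‖ξ‖ * ‖η‖, by positivity, fun q hq n => ?_⟩
    have key : ∀ n : ℕ, ((q.2 : Unitization ℂ D) ^ n) * ((ψ ξ * star (ψ η) : D) : Unitization ℂ D)
        = ((ψ ((q.1 ^ n) ξ) * star (ψ η) : D) : Unitization ℂ D) := by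
      intro n
      induction n with
      | zero => simp
      | succ n ih =>
        rw [pow_succ', mul_assoc, ih, ← Unitization.inr_mul, ← mul_assoc,
          compactGraph_apply h1 h2 hq, pow_succ']
        rfl
    rw [key, Unitization.norm_inr]
    calc _ ≤ ‖ψ ((q.1 ^ n) ξ)‖ * ‖star (ψ η)‖ := norm_mul_le _ _
      _ ≤ (‖q.1‖ ^ n * ‖ξ‖) * ‖η‖ := by
        rw [norm_star]
        gcongr
        · refine (norm_toeplitz_le h1 _).trans ?_
          refine ((q.1 ^ n).le_opNorm ξ).trans ?_
          gcongr
          rcases n.eq_zero_or_pos with rfl | hn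
          · rw [pow_zero, pow_zero]; exact ContinuousLinearMap.norm_id_le
          · exact norm_pow_le' _ hn
        · exact norm_toeplitz_le h1 _
      _ = _ := by ring
  | zero => exact ⟨0, le_rfl, fun q _ n => by simp⟩
  | add p q _ _ hp hq =>
    obtain ⟨K, hK, h⟩ := hp
    obtain ⟨K', hK', h'⟩ := hq
    refine ⟨K + K', by positivity, fun r hr n => ?_⟩
    rw [Prod.snd_add, Unitization.inr_add, mul_add, add_mul]
    exact (norm_add_le _ _).trans (add_le_add (h r hr n) (h' r hr n))
  | smul c p _ hp =>
    obtain ⟨K, hK, h⟩ := hp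
    refine ⟨‖c‖ * K, by positivity, fun r hr n => ?_⟩
    rw [Prod.smul_snd, Unitization.inr_smul, mul_smul_comm, norm_smul, mul_assoc]
    gcongr
    exact h r hr n

theorem compactGraph_norm_le (h1 : ∀ ξ η, star (ψ ξ) * ψ η = π (inner B ξ η))
    (h2 : ∀ ξ b, ψ ξ * π b = ψ (ξ <• b)) {p : (X →L[ℂ] X) × D} (hp : p ∈ compactGraph B ψ) :
    ‖p.2‖ ≤ ‖p.1‖ := by
  obtain ⟨S, hS, hadj⟩ := compactGraph_star hp
  have hq : (S * p.1, star p.2 * p.2) ∈ compactGraph B ψ := compactGraph_mul h1 h2 hS hp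
  obtain ⟨K, hK, h⟩ := compactGraph_bound h1 h2 hq
  set c : D := star p.2 * p.2 with hc
  have hcs : IsSelfAdjoint (c : Unitization ℂ D) := (IsSelfAdjoint.star_mul_self p.2).inr ℂ
  have hle : ‖c‖ ≤ ‖S * p.1‖ := by
    have hb : ∀ k : ℕ, ‖c‖ ^ 2 ^ k ≤ K * ‖S * p.1‖ ^ (2 ^ k - 1) := fun k => by
      have h5 := h _ hq (2 ^ k - 1)
      rw [← pow_succ, Nat.sub_add_cancel Nat.one_le_two_pow, hcs.norm_pow_two_pow,
        Unitization.norm_inr] at h5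
      exact h5
    rcases (norm_nonneg (S * p.1)).eq_or_lt with h0 | h0
    · have := hb 1
      rw [← h0] at this ⊢
      norm_num at this
      rw [this, norm_zero]
    · refine le_of_pow_two_pow_le (D := K / ‖S * p.1‖) h0.le fun k => ?_
      refine (hb k).trans_eq ?_
      rw [div_mul_eq_mul_div, eq_div_iff h0.ne', mul_assoc, ← pow_succ,
        Nat.sub_add_cancel Nat.one_le_two_pow]
  have h3 : ‖S * p.1‖ ≤ ‖p.1‖ * ‖p.1‖ :=
    (norm_mul_le _ _).trans (by gcongr; exact norm_le_of_adjoint hadj)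
  rw [hc, CStarRing.norm_star_mul_self] at hle
  nlinarith [norm_nonneg p.1, norm_nonneg p.2]

instance : IsBoundedSMul ℂ (compacts B X) :=
  IsBoundedSMul.of_norm_smul_le fun c T => norm_smul_le c (T : X →L[ℂ] X)

/-- The homomorphism `𝓚(X) → D`, `θ_{ξ, η} ↦ ψ(ξ) ψ(η)^*`, induced by a Toeplitz representation `ψ`
of `X`: the continuous linear extension of this assignment. -/
noncomputable def compactHom (B : Type*) {X D : Type*} [NonUnitalCStarAlgebra B] [PartialOrder B]
    [StarOrderedRing B] [NormedAddCommGroup X] [NormedSpace ℂ X] [HilbertModule B X]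
    [NonUnitalCStarAlgebra D] (ψ : X →ₗ[ℂ] D) : compacts B X →L[ℂ] D :=
  (LinearMap.snd ℂ (X →L[ℂ] X) D ∘ₗ (compactGraph B ψ).subtype).extendOfNorm
    ((LinearMap.fst ℂ (X →L[ℂ] X) D ∘ₗ (compactGraph B ψ).subtype).codRestrict (compacts B X)
      fun p => by
        have h : compactGraph B ψ ≤ (compacts B X).comap (LinearMap.fst ℂ (X →L[ℂ] X) D) :=
          Submodule.span_le.2 (by
            rintro _ ⟨ξ, η, rfl⟩
            exact theta_mem_compacts ξ η)
        exact h p.2)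

theorem compactHom_theta (h1 : ∀ ξ η, star (ψ ξ) * ψ η = π (inner B ξ η))
    (h2 : ∀ ξ b, ψ ξ * π b = ψ (ξ <• b)) (ξ η : X) :
    compactHom B ψ ⟨theta B ξ η, theta_mem_compacts ξ η⟩ = ψ ξ * star (ψ η) := by
  have hp : (theta B ξ η, ψ ξ * star (ψ η)) ∈ compactGraph B ψ := Submodule.subset_span ⟨ξ, η, rfl⟩
  refine LinearMap.extendOfNorm_eq
    (f := LinearMap.snd ℂ (X →L[ℂ] X) D ∘ₗ (compactGraph B ψ).subtype) ?_ ⟨1, fun p => ?_⟩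
      (⟨_, hp⟩ : compactGraph B ψ)
  · rw [DenseRange, Subtype.dense_iff]
    intro T hT
    refine closure_mono ?_ hT
    intro T hT
    induction hT using Submodule.span_induction with
    | mem T hT =>
      obtain ⟨ξ, η, rfl⟩ := hT
      exact ⟨_, ⟨⟨_, Submodule.subset_span ⟨ξ, η, rfl⟩⟩, rfl⟩, rfl⟩
    | zero => exact ⟨_, ⟨0, rfl⟩, rfl⟩
    | add T T' _ _ h h' =>
      obtain ⟨_, ⟨p, rfl⟩, rfl⟩ := h
      obtain ⟨_, ⟨q, rfl⟩, rfl⟩ := h'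
      exact ⟨_, ⟨p + q, rfl⟩, rfl⟩
    | smul c T _ h =>
      obtain ⟨_, ⟨p, rfl⟩, rfl⟩ := h
      exact ⟨_, ⟨c • p, rfl⟩, rfl⟩
  · rw [one_mul]
    exact compactGraph_norm_le h1 h2 p.2

end Compact

end HilbertModule

/-! ### Quasi-lattice ordered groupoids -/

section Order

variable {G : Type u} [Groupoid.{v} G]

/-- `P(x, y)`: the morphisms from `x` to `y` that belong to `P`. -/
abbrev PHom (P : MorphismProperty G) (x y : G) := {f : x ⟶ y // P f}

/-- `P(-, y)`: the morphisms with target `y` that belong to `P`. -/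
abbrev PTo (P : MorphismProperty G) (y : G) := Σ x : G, PHom P x y

variable {P : MorphismProperty G}

/-- The identity `1_x`, as a morphism in `P`. -/
def PHom.id (P : MorphismProperty G) [P.IsMultiplicative] (x : G) : PHom P x x :=
  ⟨𝟙 x, P.id_mem x⟩

/-- The identity `1_y`, as an element of `P(-, y)`. -/
def PTo.one (P : MorphismProperty G) [P.IsMultiplicative] (y : G) : PTo P y :=
  ⟨y, PHom.id P y⟩

/-- `gf`: first `f`, then `g`. -/
def PHom.comp [P.IsMultiplicative] {x y z : G} (g : PHom P y z) (f : PHom P x y) : PHom P x z :=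
  ⟨f.1 ≫ g.1, P.comp_mem _ _ f.2 g.2⟩

/-- `f ≤ g` if and only if `f⁻¹ g ∈ P`, for morphisms `f`, `g` of `G` with the same target. -/
def GLe (P : MorphismProperty G) {x x' y : G} (f : x ⟶ y) (g : x' ⟶ y) : Prop :=
  P (g ≫ Groupoid.inv f)

/-- The order `f ≤ g` on `P(-, y)`. -/
def PLe {y : G} (f g : PTo P y) : Prop := GLe P f.2.1 g.2.1

/-- `f⁻¹ g ∈ P`, when `f ≤ g`. -/
def pquot {y : G} (f g : PTo P y) (h : PLe f g) : PHom P g.1 f.1 :=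
  ⟨g.2.1 ≫ Groupoid.inv f.2.1, h⟩

theorem comp_pquot [P.IsMultiplicative] {y : G} (f g : PTo P y) (h : PLe f g) :
    f.2.comp (pquot f g h) = g.2 :=
  Subtype.ext (by simp [PHom.comp, pquot])

/-- `k = f ∨ g` is a least upper bound of `f` and `g` in `P(-, y)`. -/
def IsJoin {y : G} (f g k : PTo P y) : Prop :=
  PLe f k ∧ PLe g k ∧ ∀ k', PLe f k' → PLe g k' → PLe k k'

/-- `(G, P)` is a quasi-lattice ordered groupoid, for the wide subcategory `P` of `G`. Only
morphisms with a common target are comparable, so that finite sets of morphisms that have an upper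
bound are subsets of some `G(-, y)`. -/
structure IsQuasiLatticeOrdered (P : MorphismProperty G) : Prop where
  eq_of_mem_inv {x y : G} (f : x ⟶ y) : P f → P (Groupoid.inv f) → x = y
  eq_id_of_mem_inv {x : G} (f : x ⟶ x) : P f → P (Groupoid.inv f) → f = 𝟙 x
  exists_lub (y : G) (F : Finset (Σ x : G, (x ⟶ y))) : F.Nonempty →
    (∃ k : PTo P y, ∀ f ∈ F, GLe P f.2 k.2.1) →
    ∃ k : PTo P y, (∀ f ∈ F, GLe P f.2 k.2.1) ∧
      ∀ k' : PTo P y, (∀ f ∈ F, GLe P f.2 k'.2.1) → PLe k k'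

end Order

/-! ### Product systems -/

/-- A product system over `(G, P)`. The unitary `m_{g, f} : X_g ⊗ X_f → X_{gf}` of
C*-correspondences is given by the products `mul ξ η = m_{g, f} (ξ ⊗ η)`: a bilinear balanced
bimodule map, with total range, that carries the inner product
`⟨ξ ⊗ η, ξ' ⊗ η'⟩ = ⟨η, ⟨ξ, ξ'⟩ η'⟩` of the internal tensor product to the one of `X_{gf}`. The target
is written as any `k` with `gf = k`, so that associativity needs no transport between
`X_{h(gf)}` and `X_{(hg)f}`. The identification of `X_{1_x}` with `A_x`, with its
canonical structure of an `A_x`-`A_x` C*-correspondence, is the map `unit x`. -/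
structure ProductSystem {G : Type u} [Groupoid.{v} G] (P : MorphismProperty G)
    [P.IsMultiplicative] where
  A : G → Type w₁
  [cstar : ∀ x, NonUnitalCStarAlgebra (A x)]
  [order : ∀ x, PartialOrder (A x)]
  [starOrdered : ∀ x, StarOrderedRing (A x)]
  X : ∀ {x y : G}, PHom P x y → Type w₂
  [normed : ∀ {x y : G} (f : PHom P x y), NormedAddCommGroup (X f)]
  [space : ∀ {x y : G} (f : PHom P x y), NormedSpace ℂ (X f)]
  [complete : ∀ {x y : G} (f : PHom P x y), CompleteSpace (X f)]
  [hilbert : ∀ {x y : G} (f : PHom P x y), HilbertModule (A x) (X f)]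
  left : ∀ {x y : G} (f : PHom P x y), LeftAction (A y) (A x) (X f)
  mul : ∀ {x y z : G} (g : PHom P y z) (f : PHom P x y) (k : PHom P x z), g.comp f = k →
    (X g →ₗ[ℂ] X f →ₗ[ℂ] X k)
  mul_left {x y z : G} (g : PHom P y z) (f : PHom P x y) (k : PHom P x z) (h : g.comp f = k)
    (a : A z) (ξ : X g) (η : X f) :
    mul g f k h ((left g).φ a ξ) η = (left k).φ a (mul g f k h ξ η)
  mul_right {x y z : G} (g : PHom P y z) (f : PHom P x y) (k : PHom P x z) (h : g.comp f = k)
    (ξ : X g) (η : X f) (b : A x) :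
    mul g f k h ξ (η <• b) = (mul g f k h ξ η) <• b
  mul_balanced {x y z : G} (g : PHom P y z) (f : PHom P x y) (k : PHom P x z) (h : g.comp f = k)
    (ξ : X g) (b : A y) (η : X f) :
    mul g f k h (ξ <• b) η = mul g f k h ξ ((left f).φ b η)
  inner_mul {x y z : G} (g : PHom P y z) (f : PHom P x y) (k : PHom P x z) (h : g.comp f = k)
    (ξ ξ' : X g) (η η' : X f) :
    inner (A x) (mul g f k h ξ η) (mul g f k h ξ' η') =
      inner (A x) η ((left f).φ (inner (A y) ξ ξ') η')
  mul_total {x y z : G} (g : PHom P y z) (f : PHom P x y) (k : PHom P x z) (h : g.comp f = k) :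
    (Submodule.span ℂ {ζ | ∃ ξ η, ζ = mul g f k h ξ η}).topologicalClosure = ⊤
  unit : ∀ x : G, A x ≃ₗ[ℂ] X (PHom.id P x)
  left_unit (x : G) (a b : A x) : (left (PHom.id P x)).φ a (unit x b) = unit x (a * b)
  unit_rsmul (x : G) (a b : A x) : unit x a <• b = unit x (a * b)
  inner_unit (x : G) (a b : A x) : inner (A x) (unit x a) (unit x b) = star a * b
  unit_mul {x y : G} (f : PHom P x y) (h : (PHom.id P y).comp f = f) (a : A y) (ξ : X f) :
    mul (PHom.id P y) f f h (unit y a) ξ = (left f).φ a ξ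
  mul_unit {x y : G} (f : PHom P x y) (h : f.comp (PHom.id P x) = f) (ξ : X f) (b : A x) :
    mul f (PHom.id P x) f h ξ (unit x b) = ξ <• b
  mul_assoc {w x y z : G} (h : PHom P y z) (g : PHom P x y) (f : PHom P w x)
    (hg : PHom P x z) (gf : PHom P w y) (k : PHom P w z)
    (e₁ : h.comp g = hg) (e₂ : hg.comp f = k) (e₃ : g.comp f = gf) (e₄ : h.comp gf = k)
    (ξ : X h) (η : X g) (ζ : X f) :
    mul hg f k e₂ (mul h g hg e₁ ξ η) ζ = mul h gf k e₄ ξ (mul g f gf e₃ η ζ)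

attribute [instance] ProductSystem.cstar ProductSystem.order ProductSystem.starOrdered
  ProductSystem.normed ProductSystem.space ProductSystem.complete ProductSystem.hilbert

namespace ProductSystem

variable {G : Type u} [Groupoid.{v} G] {P : MorphismProperty G} [P.IsMultiplicative]

/-- The left action `φ_f : A_{t(f)} → 𝓛(X_f)`. -/
def φ (X : ProductSystem.{u, v, w₁, w₂} P) {x y : G} (f : PHom P x y) :
    X.A y →ₙₐ[ℂ] (X.X f →L[ℂ] X.X f) :=
  (X.left f).φ

/-- `𝓛(X_f)`. -/
abbrev 𝓛 (X : ProductSystem.{u, v, w₁, w₂} P) {x y : G} (f : PHom P x y) :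
    Submodule ℂ (X.X f →L[ℂ] X.X f) :=
  adjointable (X.A x) (X.X f)

/-- `𝓚(X_f)`. -/
noncomputable abbrev 𝓚 (X : ProductSystem.{u, v, w₁, w₂} P) {x y : G} (f : PHom P x y) :
    Submodule ℂ (X.X f →L[ℂ] X.X f) :=
  compacts (X.A x) (X.X f)

/-- A compact operator, as an adjointable operator. -/
def ofCompact (X : ProductSystem.{u, v, w₁, w₂} P) {x y : G} {f : PHom P x y} (T : X.𝓚 f) : X.𝓛 f :=
  ⟨T.1, compacts_le_adjointable T.2⟩

open Classical in
/-- The homomorphism `l_f^g : 𝓛(X_f) → 𝓛(X_g)`, given by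
`l_f^g (T) = m_{f, f⁻¹g} (T ⊗ I) m_{f, f⁻¹g}^*` if `f ≤ g`, and by `0` otherwise. -/
noncomputable def l (X : ProductSystem.{u, v, w₁, w₂} P) {y : G} (f g : PTo P y) (T : X.𝓛 f.2) :
    X.𝓛 g.2 :=
  if h : PLe f g then
    ⟨lift (X.mul f.2 (pquot f g h) g.2 (comp_pquot f g h)) T.1,
      lift_mem (X.inner_mul _ _ _ _) (X.mul_total _ _ _ _) T.2⟩
  else 0

/-- For `f ≤ g`, the operator `l_f^g (T)` is the one with `l_f^g (T) (ξ η) = (T ξ) η`. -/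
theorem l_mul (X : ProductSystem.{u, v, w₁, w₂} P) {y : G} (f g : PTo P y) (h : PLe f g)
    (T : X.𝓛 f.2) (ξ : X.X f.2) (η : X.X (pquot f g h)) :
    (X.l f g T).1 (X.mul f.2 (pquot f g h) g.2 (comp_pquot f g h) ξ η) =
      X.mul f.2 (pquot f g h) g.2 (comp_pquot f g h) (T.1 ξ) η := by
  rw [l, dif_pos h]
  exact lift_mul (X.inner_mul _ _ _ _) (X.mul_total _ _ _ _) T.2 ξ η

/-- `X` is compactly aligned: `S ∨ T = l_f^{f∨g}(S) l_g^{f∨g}(T)` is compact for all compact `S`, `T`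
and all `f`, `g` for which `f ∨ g` exists. -/
def IsCompactlyAligned (X : ProductSystem.{u, v, w₁, w₂} P) : Prop :=
  ∀ (y : G) (f g k : PTo P y), IsJoin f g k → ∀ (S : X.𝓚 f.2) (T : X.𝓚 g.2),
    (X.l f k (X.ofCompact S)).1 * (X.l g k (X.ofCompact T)).1 ∈ X.𝓚 k.2

/-! ### The augmented modules -/

open Classical in
/-- The ideal `I_g` of `A_y`, for `g ∈ P(y, y)`: it is `A_y` if `g = 1_y`, and otherwise the
intersection of the kernels of `φ_f` over all `f ∈ P(-, y)` with `1_y < f ≤ g`. (The ideals `I_g` with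
`g ∈ P(x, y)` and `x ≠ y` do not occur in the definition of the augmented modules.) -/
noncomputable def idealI (X : ProductSystem.{u, v, w₁, w₂} P) {y : G} (g : PHom P y y) :
    Set (X.A y) :=
  if g = PHom.id P y then Set.univ
  else {a | ∀ f : PTo P y, f ≠ PTo.one P y → PLe f ⟨y, g⟩ → X.φ f.2 a = 0}

/-- The closed submodule `X_h I` of `X_h`. -/
def submoduleMul (X : ProductSystem.{u, v, w₁, w₂} P) {x y : G} (h : PHom P x y)
    (I : Set (X.A x)) : Submodule ℂ (X.X h) :=
  (Submodule.span ℂ {ζ | ∃ ξ : X.X h, ∃ a ∈ I, ζ = ξ <• a}).topologicalClosure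

/-- The index set `{h ∈ P(s(g), y) : h ≤ g}`. -/
abbrev Below {y : G} (g : PTo P y) := {h : PHom P g.1 y // PLe ⟨g.1, h⟩ g}

/-- The augmented module `X̃_g`, that is, the Hilbert module direct sum of the modules
`X_h I_{h⁻¹g}`, `h ∈ P(s(g), y)`, `h ≤ g`, which is the completion of the finitely supported
families: it consists of the families `ξ` for which `∑ ⟨ξ(h), ξ(h)⟩` converges in norm
(unconditionally). -/
def Xtilde (X : ProductSystem.{u, v, w₁, w₂} P) {y : G} (g : PTo P y) :
    Set (∀ h : Below g, X.X h.1) :=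
  {ξ | (∀ h : Below g, ξ h ∈ X.submoduleMul h.1 (X.idealI (pquot ⟨g.1, h.1⟩ g h.2))) ∧
    Summable fun h : Below g => inner (X.A g.1) (ξ h) (ξ h)}

/-- The operator `l̃_f^g (T)`, given by `(l̃_f^g (T) ξ)(h) = l_f^h (T) (ξ(h))`. It is written as an
operator on all families, to be applied to those in `X̃_g`. -/
noncomputable def ltilde (X : ProductSystem.{u, v, w₁, w₂} P) {y : G} (f g : PTo P y)
    (T : X.𝓛 f.2) (ξ : ∀ h : Below g, X.X h.1) (h : Below g) : X.X h.1 :=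
  (X.l f ⟨g.1, h.1⟩ T).1 (ξ h)

end ProductSystem

/-- A statement about the elements `g` of `P(-, y)` is true for large `g` if for every `f` there is
`h ≥ f` such that it is true for all `g ≥ h`. -/
def ForLarge {G : Type u} [Groupoid.{v} G] {P : MorphismProperty G} {y : G}
    (p : PTo P y → Prop) : Prop :=
  ∀ f : PTo P y, ∃ h : PTo P y, PLe f h ∧ ∀ g : PTo P y, PLe h g → p g

/-! ### Toeplitz representations -/

/-- A Toeplitz representation of `X` in the C*-algebra `D`. (That `ψ_{1_x}` is a `*`-homomorphism on
`A_x = X_{1_x}` is spelled out in `map_unit_mul` and `map_unit_star`.) -/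
structure ToeplitzRep {G : Type u} [Groupoid.{v} G] {P : MorphismProperty G} [P.IsMultiplicative]
    (X : ProductSystem.{u, v, w₁, w₂} P) (D : Type w₃) [NonUnitalCStarAlgebra D] where
  ψ : ∀ {x y : G} (f : PHom P x y), X.X f →ₗ[ℂ] D
  map_unit_mul (x : G) (a b : X.A x) :
    ψ (PHom.id P x) (X.unit x (a * b)) =
      ψ (PHom.id P x) (X.unit x a) * ψ (PHom.id P x) (X.unit x b)
  map_unit_star (x : G) (a : X.A x) :
    ψ (PHom.id P x) (X.unit x (star a)) = star (ψ (PHom.id P x) (X.unit x a))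
  map_mul {x y z : G} (g : PHom P y z) (f : PHom P x y) (k : PHom P x z) (h : g.comp f = k)
    (β : X.X g) (ξ : X.X f) : ψ g β * ψ f ξ = ψ k (X.mul g f k h β ξ)
  map_inner {x y : G} (f : PHom P x y) (η ξ : X.X f) :
    star (ψ f η) * ψ f ξ = ψ (PHom.id P x) (X.unit x (inner (X.A x) η ξ))

namespace ToeplitzRep

variable {G : Type u} [Groupoid.{v} G] {P : MorphismProperty G} [P.IsMultiplicative]
  {X : ProductSystem.{u, v, w₁, w₂} P} {D : Type w₃} [NonUnitalCStarAlgebra D]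

/-- The `*`-homomorphism `ψ_{1_x} : A_x → D`. -/
def coeff (ψ : ToeplitzRep X D) (x : G) : X.A x →⋆ₙₐ[ℂ] D where
  toFun a := ψ.ψ (PHom.id P x) (X.unit x a)
  map_smul' c a := by rw [map_smul, map_smul]; rfl
  map_zero' := by rw [map_zero, map_zero]
  map_add' a b := by rw [map_add, map_add]
  map_mul' := ψ.map_unit_mul x
  map_star' := ψ.map_unit_star x

/-- The homomorphism `ψ^{(f)} : 𝓚(X_f) → D` with `ψ^{(f)}(θ_{ξ, η}) = ψ_f(ξ) ψ_f(η)^*`. -/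
noncomputable def onCompacts (ψ : ToeplitzRep X D) {x y : G} (f : PHom P x y) : X.𝓚 f →L[ℂ] D :=
  compactHom (X.A x) (ψ.ψ f)

theorem onCompacts_theta (ψ : ToeplitzRep X D) {x y : G} (f : PHom P x y) (ξ η : X.X f) :
    ψ.onCompacts f ⟨theta (X.A x) ξ η, theta_mem_compacts ξ η⟩ = ψ.ψ f ξ * star (ψ.ψ f η) := by
  have hcomp : f.comp (PHom.id P x) = f := Subtype.ext (Category.id_comp f.1)
  refine compactHom_theta (π := ψ.coeff x) (ψ.map_inner f) (fun ξ b => ?_) ξ η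
  rw [← X.mul_unit f hcomp]
  exact ψ.map_mul f (PHom.id P x) f hcomp ξ (X.unit x b)

/-- `ψ` is Cuntz–Pimsner covariant: `∑_{f ∈ F} ψ^{(f)}(T_f) = 0` for every finite `F ⊆ P(-, y)` and all
compact operators `T_f` on `X_f` such that `∑_{f ∈ F} l̃_f^g (T_f) = 0` on `X̃_g` for large `g`. -/
def IsCuntzPimsnerCovariant (ψ : ToeplitzRep X D) : Prop :=
  ∀ (y : G) (F : Finset (PTo P y)) (T : ∀ f : PTo P y, X.𝓚 f.2),
    (ForLarge fun g : PTo P y => ∀ ξ ∈ X.Xtilde g,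
      ∑ f ∈ F, X.ltilde f g (X.ofCompact (T f)) ξ = 0) →
    ∑ f ∈ F, ψ.onCompacts f.2 (T f) = 0

end ToeplitzRep

end PSys

/-! Both implications compare the operators `l_f^g (T)` on the single module `X_g`, the summand `h =
g` of `X̃_g`; its ideal is `I_{1} = A`, so it occurs in full.

For (1), injectivity of the left actions makes `I_k` vanish for `k ≠ 1`, so `X̃_g` is just `X_g`
(`Xtilde_apply_eq_zero`). If `φ_f(a)` is compact, then `l_f^g` carries `φ_f(a)` to `φ_g(a)` for
every `g ≥ f`, and `l_{1}^g` carries `φ_{1}(a)` to the same operator (`l_apply_φ`). Elements above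
`f` are cofinal because joins exist, so covariance for the pair `φ_f(a)`, `-φ_{1}(a)` gives
`ψ^{(f)}(φ_f(a)) = ψ^{(1)}(φ_{1}(a))`, and the right side is `ψ_{1}(a)` (`onCompacts_φ_id`).

For (2), the key is `ψ^{(g)} ∘ l_f^g = ψ^{(f)}` on compact operators (`onCompacts_l`). With creation
operators `T_ξ : X_{f⁻¹g} → X_g`, one has `θ_{ξa,η} ⊗ I = T_ξ φ(a) T_η^*` (`lift_theta_rsmul`).
Since `φ(a)` is compact, so is this operator, and `ψ^{(g)}` sends it to `ψ_f(ξ) ψ^{(f⁻¹g)}(φ(a))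
ψ_f(η)^*` (`onCompacts_sandwich`). By hypothesis the middle factor is the image of `a`, which leaves
`ψ_f(ξa) ψ_f(η)^* = ψ^{(f)}(θ_{ξa,η})`. Vectors `ξa` are total, so the identity extends to all
compact operators. A relation `∑ l̃_f^g (T_f) = 0` at one `g` above all of `F` then becomes `∑
ψ^{(f)}(T_f) = 0` on applying `ψ^{(g)}` to its `X_g` component. -/

namespace PSys

namespace HilbertModule

/-! ### Density arguments for compact operators. -/

section CompactsClosure

variable {B X : Type*} [NonUnitalCStarAlgebra B] [PartialOrder B] [StarOrderedRing B]
  [NormedAddCommGroup X] [NormedSpace ℂ X] [HilbertModule B X]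

theorem rsmul_mul (x : X) (a b : B) : x <• (a * b) = (x <• a) <• b :=
  eq_of_inner B fun z => by simp only [inner_rsmul, mul_assoc]

variable (B) in
/-- The continuous linear map `ξ ↦ θ_{ξ, η}`. -/
noncomputable def thetaL (η : X) : X →L[ℂ] (X →L[ℂ] X) :=
  LinearMap.mkContinuous
    { toFun := fun ξ => theta B ξ η
      map_add' := fun a b => by
        ext ζ
        exact add_rsmul a b _
      map_smul' := fun c a => by
        ext ζ
        exact smul_rsmul c a _ }
    ‖η‖ fun ξ => by
      rw [mul_comm]
      exact LinearMap.mkContinuous_norm_le (theta B ξ η : X →ₗ[ℂ] X) (by positivity) fun ζ => by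
        rw [mul_assoc]
        exact (norm_rsmul_le _ _).trans
          (mul_le_mul_of_nonneg_left (norm_inner_le B η ζ) (norm_nonneg _))

theorem isClosed_compacts : IsClosed (compacts B X : Set (X →L[ℂ] X)) :=
  Submodule.isClosed_topologicalClosure _

/-- A closed subspace that contains the operators `θ_{ξ, η}`, for all `ξ` in a total set, contains all
compact operators. -/
theorem compacts_le_of_theta_mem {q : Submodule ℂ (X →L[ℂ] X)}
    (hq : IsClosed (q : Set (X →L[ℂ] X))) {s : Set X}
    (hs : (Submodule.span ℂ s).topologicalClosure = ⊤)
    (h : ∀ ξ ∈ s, ∀ η, theta B ξ η ∈ q) : compacts B X ≤ q := by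
  refine Submodule.topologicalClosure_minimal _ (Submodule.span_le.2 ?_) hq
  rintro _ ⟨ξ, η, rfl⟩
  -- For fixed `η`, the vectors `ξ` with `θ_{ξ,η} ∈ q` form a closed subspace, so totality of `s`
  -- suffices.
  have h1 : (Submodule.span ℂ s).topologicalClosure ≤
      q.comap (thetaL B η : X →ₗ[ℂ] (X →L[ℂ] X)) :=
    Submodule.topologicalClosure_minimal _ (Submodule.span_le.2 fun ξ hξ => h ξ hξ η)
      (hq.preimage (thetaL B η).continuous)
  rw [hs] at h1
  exact h1 (Submodule.mem_top (x := ξ))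

/-- This relative form serves maps defined only on `𝓚(X)`, such as `ψ^{(f)}`: `q` will be an
equalizer or a preimage under a continuous linear map. It reduces to the absolute form because
`𝓚(X)` is closed, so that closed in `𝓚(X)` means closed among all operators. -/
theorem eq_top_of_theta_mem {q : Submodule ℂ (compacts B X)}
    (hq : IsClosed (q : Set (compacts B X))) {s : Set X}
    (hs : (Submodule.span ℂ s).topologicalClosure = ⊤)
    (h : ∀ ξ ∈ s, ∀ η, (⟨theta B ξ η, theta_mem_compacts ξ η⟩ : compacts B X) ∈ q) : q = ⊤ := by
  have hc : IsClosed (q.map (compacts B X).subtype : Set (X →L[ℂ] X)) := by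
    rw [Submodule.map_coe]
    exact (isClosed_compacts (B := B) (X := X)).isClosedEmbedding_subtypeVal.isClosedMap _ hq
  have h1 := compacts_le_of_theta_mem hc hs fun ξ hξ η => ⟨_, h ξ hξ η, rfl⟩
  refine Submodule.eq_top_iff'.2 fun T => ?_
  obtain ⟨T', hT', e⟩ := h1 T.2
  rwa [← Subtype.ext (a1 := T') (a2 := T) e]

theorem span_univ_topologicalClosure :
    (Submodule.span ℂ (Set.univ : Set X)).topologicalClosure = ⊤ := by
  rw [Submodule.span_univ]
  exact top_le_iff.1 (Submodule.le_topologicalClosure _)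

end CompactsClosure

/-! ### Creation and annihilation operators, and the operators `T ⊗ I`. -/

section Creation

open TensorProduct

variable {B C E F W : Type*} [NonUnitalCStarAlgebra B] [PartialOrder B] [StarOrderedRing B]
  [NonUnitalCStarAlgebra C] [PartialOrder C] [StarOrderedRing C]
  [NormedAddCommGroup E] [NormedSpace ℂ E] [HilbertModule C E]
  [NormedAddCommGroup F] [NormedSpace ℂ F] [HilbertModule B F]
  [NormedAddCommGroup W] [NormedSpace ℂ W] [HilbertModule B W]
  {m : E →ₗ[ℂ] F →ₗ[ℂ] W} {L : LeftAction C B F}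

/-- Cauchy–Schwarz applied to `⟨η, φ(⟨ξ, ξ⟩) η⟩`. Keeping the operator norm of `φ(⟨ξ, ξ⟩)` in the
constant makes it unnecessary to know that `φ` is contractive. -/
theorem norm_map_le
    (hm : ∀ ξ ξ' η η', inner B (m ξ η) (m ξ' η') = inner B η (L.φ (inner C ξ ξ') η'))
    (ξ : E) (η : F) : ‖m ξ η‖ ≤ √‖L.φ (inner C ξ ξ)‖ * ‖η‖ := by
  have h : ‖m ξ η‖ ^ 2 ≤ (√‖L.φ (inner C ξ ξ)‖ * ‖η‖) ^ 2 := by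
    rw [mul_pow, Real.sq_sqrt (norm_nonneg _), norm_sq (B := B), hm]
    calc _ ≤ ‖η‖ * ‖L.φ (inner C ξ ξ) η‖ := norm_inner_le B _ _
      _ ≤ ‖η‖ * (‖L.φ (inner C ξ ξ)‖ * ‖η‖) := by gcongr; exact ContinuousLinearMap.le_opNorm _ _
      _ = _ := by ring
  exact (sq_le_sq₀ (norm_nonneg _) (by positivity)).1 h

/-- The creation operator `η ↦ m (ξ ⊗ η)`. -/
noncomputable def creation
    (hm : ∀ ξ ξ' η η', inner B (m ξ η) (m ξ' η') = inner B η (L.φ (inner C ξ ξ') η'))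
    (ξ : E) : F →L[ℂ] W :=
  (m ξ).mkContinuous _ (norm_map_le hm ξ)

/-- The map `ζ ⊗ ω ↦ φ(⟨η, ζ⟩) ω` on the algebraic tensor product. -/
noncomputable def annihilationTmul (L : LeftAction C B F) (η : E) : E ⊗[ℂ] F →ₗ[ℂ] F :=
  TensorProduct.lift
    ((ContinuousLinearMap.coeLM ℂ ∘ₗ (L.φ : C →ₗ[ℂ] (F →L[ℂ] F))) ∘ₗ innerL C η)

theorem annihilationTmul_tmul (η ζ : E) (ω : F) :
    annihilationTmul L η (ζ ⊗ₜ ω) = L.φ (inner C η ζ) ω := by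
  simp [annihilationTmul, innerL]

/-- Adjointness to the creation operator on the algebraic level. It yields the norm bound below, and
with it the extension to `W`. -/
theorem inner_annihilationTmul
    (hm : ∀ ξ ξ' η η', inner B (m ξ η) (m ξ' η') = inner B η (L.φ (inner C ξ ξ') η'))
    (η : E) (ν : F) (u : E ⊗[ℂ] F) :
    inner B ν (annihilationTmul L η u) = inner B (m η ν) (tmap m 1 u) := by
  induction u using TensorProduct.induction_on with
  | zero => rw [map_zero, map_zero, inner_zero_right, inner_zero_right]
  | add u u' h h' => rw [map_add, map_add, inner_add_right, inner_add_right, h, h']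
  | tmul ζ ω =>
    rw [annihilationTmul_tmul, tmap_tmul, one_apply_eq_self, hm]

/-- The usual bound for an adjoint: pair `ν`, the image of `u`, with itself, move one copy to the
other side as `m η ν`, and divide by `‖ν‖`. -/
theorem norm_annihilationTmul_le
    (hm : ∀ ξ ξ' η η', inner B (m ξ η) (m ξ' η') = inner B η (L.φ (inner C ξ ξ') η'))
    (η : E) (u : E ⊗[ℂ] F) :
    ‖annihilationTmul L η u‖ ≤ √‖L.φ (inner C η η)‖ * ‖tmap m 1 u‖ := by
  set K := √‖L.φ (inner C η η)‖
  set ν := annihilationTmul L η u with hν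
  have h : ‖ν‖ ^ 2 ≤ K * ‖ν‖ * ‖tmap m 1 u‖ := by
    rw [norm_sq (B := B)]
    nth_rw 2 [hν]
    rw [inner_annihilationTmul hm]
    refine (norm_inner_le B _ _).trans ?_
    gcongr
    exact norm_map_le hm η ν
  rcases (norm_nonneg ν).eq_or_lt with h0 | h0
  · rw [← h0]; positivity
  · nlinarith

/-- The annihilation operator `m (ζ ⊗ ω) ↦ φ(⟨η, ζ⟩) ω`, the adjoint of the creation operator. -/
noncomputable def annihilation [CompleteSpace F] (m : E →ₗ[ℂ] F →ₗ[ℂ] W) (L : LeftAction C B F) (η : E) : W →L[ℂ] F :=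
  (annihilationTmul L η).extendOfNorm (tmap m 1)

theorem annihilation_tmap [CompleteSpace F]
    (hm : ∀ ξ ξ' η η', inner B (m ξ η) (m ξ' η') = inner B η (L.φ (inner C ξ ξ') η'))
    (htot : (Submodule.span ℂ {ζ | ∃ ξ η, ζ = m ξ η}).topologicalClosure = ⊤)
    (η : E) (u : E ⊗[ℂ] F) : annihilation m L η (tmap m 1 u) = annihilationTmul L η u :=
  LinearMap.extendOfNorm_eq (denseRange_tmap htot) ⟨_, norm_annihilationTmul_le hm η⟩ u

theorem annihilation_mul [CompleteSpace F]
    (hm : ∀ ξ ξ' η η', inner B (m ξ η) (m ξ' η') = inner B η (L.φ (inner C ξ ξ') η'))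
    (htot : (Submodule.span ℂ {ζ | ∃ ξ η, ζ = m ξ η}).topologicalClosure = ⊤)
    (η ζ : E) (ω : F) : annihilation m L η (m ζ ω) = L.φ (inner C η ζ) ω := by
  rw [← annihilationTmul_tmul, ← annihilation_tmap hm htot, tmap_tmul]
  rfl

theorem inner_annihilation [CompleteSpace F]
    (hm : ∀ ξ ξ' η η', inner B (m ξ η) (m ξ' η') = inner B η (L.φ (inner C ξ ξ') η'))
    (htot : (Submodule.span ℂ {ζ | ∃ ξ η, ζ = m ξ η}).topologicalClosure = ⊤)
    (η : E) (ν : F) (w : W) : inner B ν (annihilation m L η w) = inner B (m η ν) w := by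
  refine (denseRange_tmap htot).induction_on
    (p := fun w => inner B ν (annihilation m L η w) = inner B (m η ν) w) w
    (isClosed_eq ((continuous_inner_right _).comp (annihilation m L η).continuous)
      (continuous_inner_right _)) fun u => ?_
  rw [annihilation_tmap hm htot, inner_annihilationTmul hm]

variable (L) in
/-- The map `S ↦ T_ξ S T_η^*`, for the creation operators `T_ξ` and `T_η`. -/
noncomputable def sandwich [CompleteSpace F]
    (hm : ∀ ξ ξ' η η', inner B (m ξ η) (m ξ' η') = inner B η (L.φ (inner C ξ ξ') η'))
    (ξ η : E) : (F →L[ℂ] F) →L[ℂ] (W →L[ℂ] W) :=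
  (ContinuousLinearMap.compL ℂ W F W (creation hm ξ)) ∘L
    (ContinuousLinearMap.compL ℂ W F F).flip (annihilation m L η)

theorem sandwich_apply [CompleteSpace F]
    (hm : ∀ ξ ξ' η η', inner B (m ξ η) (m ξ' η') = inner B η (L.φ (inner C ξ ξ') η'))
    (ξ η : E) (S : F →L[ℂ] F) (w : W) :
    sandwich L hm ξ η S w = m ξ (S (annihilation m L η w)) := rfl

/-- Right linearity of `m` and adjointness of `T_η^*` move both operators into the rank one
operator. This is why conjugation by creation operators preserves compactness. -/
theorem sandwich_theta [CompleteSpace F]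
    (hm : ∀ ξ ξ' η η', inner B (m ξ η) (m ξ' η') = inner B η (L.φ (inner C ξ ξ') η'))
    (htot : (Submodule.span ℂ {ζ | ∃ ξ η, ζ = m ξ η}).topologicalClosure = ⊤)
    (hr : ∀ (ξ : E) (η : F) (b : B), m ξ (η <• b) = m ξ η <• b)
    (ξ η : E) (μ ν : F) : sandwich L hm ξ η (theta B μ ν) = theta B (m ξ μ) (m η ν) := by
  ext w
  rw [sandwich_apply, theta_apply, theta_apply, inner_annihilation hm htot, hr]

theorem sandwich_mem_compacts [CompleteSpace F]
    (hm : ∀ ξ ξ' η η', inner B (m ξ η) (m ξ' η') = inner B η (L.φ (inner C ξ ξ') η'))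
    (htot : (Submodule.span ℂ {ζ | ∃ ξ η, ζ = m ξ η}).topologicalClosure = ⊤)
    (hr : ∀ (ξ : E) (η : F) (b : B), m ξ (η <• b) = m ξ η <• b)
    (ξ η : E) {S : F →L[ℂ] F} (hS : S ∈ compacts B F) : sandwich L hm ξ η S ∈ compacts B W :=
  compacts_le_of_theta_mem
    (q := (compacts B W).comap (sandwich L hm ξ η : (F →L[ℂ] F) →ₗ[ℂ] (W →L[ℂ] W)))
    (isClosed_compacts.preimage (sandwich L hm ξ η).continuous) span_univ_topologicalClosure
    (fun μ _ ν => by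
      rw [Submodule.mem_comap, ContinuousLinearMap.coe_coe, sandwich_theta hm htot hr]
      exact theta_mem_compacts _ _) hS

theorem ext_of_total
    (htot : (Submodule.span ℂ {ζ | ∃ ξ η, ζ = m ξ η}).topologicalClosure = ⊤)
    {R S : W →L[ℂ] W} (h : ∀ ξ η, R (m ξ η) = S (m ξ η)) : R = S := by
  refine ContinuousLinearMap.ext_on (Submodule.dense_iff_topologicalClosure_eq_top.2 htot) ?_
  rintro _ ⟨ξ, η, rfl⟩
  exact h ξ η

/-- If `m` is balanced, then `θ_{ξ a, η} ⊗ I = T_ξ φ(a) T_η^*`. -/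
theorem lift_theta_rsmul [CompleteSpace F] [CompleteSpace W]
    (hm : ∀ ξ ξ' η η', inner B (m ξ η) (m ξ' η') = inner B η (L.φ (inner C ξ ξ') η'))
    (htot : (Submodule.span ℂ {ζ | ∃ ξ η, ζ = m ξ η}).topologicalClosure = ⊤)
    (hb : ∀ (ξ : E) (c : C) (η : F), m (ξ <• c) η = m ξ (L.φ c η))
    (ξ η : E) (a : C) : lift m (theta C (ξ <• a) η) = sandwich L hm ξ η (L.φ a) := by
  refine ext_of_total htot fun ζ ω => ?_
  -- On `ζ ⊗ ω` both sides are `ξ ⊗ φ(a) φ(⟨η, ζ⟩) ω`: balancing moves `a⟨η, ζ⟩` across the tensor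
  -- sign.
  rw [lift_mul hm htot (theta_mem_adjointable _ _), sandwich_apply, annihilation_mul hm htot,
    theta_apply, ← rsmul_mul, hb, map_mul]
  rfl

/-- The square of the norm is controlled by `‖S T‖` with `S` the adjoint of `T`, and `‖S‖ ≤ ‖T‖`.
The bound makes `T ↦ T ⊗ I` continuous, as density arguments require. -/
theorem norm_lift_le [CompleteSpace W]
    (hm : ∀ ξ ξ' η η', inner B (m ξ η) (m ξ' η') = inner B η (L.φ (inner C ξ ξ') η'))
    (htot : (Submodule.span ℂ {ζ | ∃ ξ η, ζ = m ξ η}).topologicalClosure = ⊤)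
    {T : E →L[ℂ] E} (hT : T ∈ adjointable C E) : ‖lift m T‖ ≤ ‖T‖ := by
  refine (lift m T).opNorm_le_bound (norm_nonneg _) fun w => ?_
  refine (denseRange_tmap htot).induction_on (p := fun w => ‖lift m T w‖ ≤ ‖T‖ * ‖w‖) w
    (isClosed_le (lift m T).continuous.norm (continuous_const.mul continuous_norm)) fun u => ?_
  rw [lift_tmap hm htot hT]
  obtain ⟨S, hS⟩ := hT
  have h : ‖tmap m T u‖ ^ 2 ≤ (‖T‖ * ‖tmap m 1 u‖) ^ 2 := by
    refine (norm_tmap_le hm hS u).trans ?_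
    rw [mul_pow, sq ‖T‖]
    gcongr
    exact (norm_mul_le _ _).trans (by gcongr; exact norm_le_of_adjoint hS)
  exact (sq_le_sq₀ (norm_nonneg _) (by positivity)).1 h

/-- The continuous linear map `T ↦ T ⊗ I` on the compact operators. -/
noncomputable def liftCompacts [CompleteSpace E] [CompleteSpace W]
    (hm : ∀ ξ ξ' η η', inner B (m ξ η) (m ξ' η') = inner B η (L.φ (inner C ξ ξ') η'))
    (htot : (Submodule.span ℂ {ζ | ∃ ξ η, ζ = m ξ η}).topologicalClosure = ⊤) :
    compacts C E →L[ℂ] (W →L[ℂ] W) :=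
  LinearMap.mkContinuous
    { toFun := fun T => lift m T.1
      map_add' := fun S T => ext_of_total htot fun ζ ω => by
        rw [add_apply, lift_mul hm htot (compacts_le_adjointable (S + T).2),
          lift_mul hm htot (compacts_le_adjointable S.2),
          lift_mul hm htot (compacts_le_adjointable T.2), Submodule.coe_add, add_apply, map_add,
          LinearMap.add_apply]
      map_smul' := fun c T => ext_of_total htot fun ζ ω => by
        rw [RingHom.id_apply, smul_apply, lift_mul hm htot (compacts_le_adjointable (c • T).2),
          lift_mul hm htot (compacts_le_adjointable T.2), Submodule.coe_smul, smul_apply, map_smul,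
          LinearMap.smul_apply] }
    1 fun T => by
      rw [one_mul]
      exact norm_lift_le hm htot (compacts_le_adjointable T.2)

end Creation

end HilbertModule

open HilbertModule

/-! ### The order on `P(-, y)`. -/

section Order

variable {G : Type u} [Groupoid.{v} G] {P : MorphismProperty G} [P.IsMultiplicative]

theorem PLe.refl {y : G} (f : PTo P y) : PLe f f := by
  simpa [PLe, GLe] using P.id_mem f.1

theorem PLe.trans {y : G} {f g h : PTo P y} (h₁ : PLe f g) (h₂ : PLe g h) : PLe f h := by
  have := P.comp_mem _ _ h₂ h₁
  simpa [PLe, GLe] using this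

theorem PTo.one_le {y : G} (f : PTo P y) : PLe (PTo.one P y) f := by
  simpa [PLe, GLe, PTo.one, PHom.id] using f.2.2

theorem pquot_self {y : G} (f : PTo P y) (h : PLe f f) : pquot f f h = PHom.id P f.1 :=
  Subtype.ext (by simp [pquot, PHom.id])

theorem eq_of_pquot_eq_id {x y : G} {f g : PHom P x y} (h : PLe (⟨x, f⟩ : PTo P y) ⟨x, g⟩)
    (e : pquot (⟨x, f⟩ : PTo P y) ⟨x, g⟩ h = PHom.id P x) : f = g := by
  have h1 := comp_pquot (⟨x, f⟩ : PTo P y) ⟨x, g⟩ h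
  rw [e] at h1
  exact (Subtype.ext (Category.id_comp f.1)).symm.trans h1

theorem exists_upper_bound {y : G} (hjoin : ∀ f g : PTo P y, ∃ k : PTo P y, IsJoin f g k)
    (F : Finset (PTo P y)) : ∃ k : PTo P y, ∀ f ∈ F, PLe f k := by
  classical
  induction F using Finset.induction_on with
  | empty => exact ⟨PTo.one P y, fun f hf => absurd hf (Finset.notMem_empty f)⟩
  | insert f F _ ih =>
    obtain ⟨k, hk⟩ := ih
    obtain ⟨k', h1, h2, -⟩ := hjoin f k
    refine ⟨k', fun g hg => ?_⟩
    rcases Finset.mem_insert.1 hg with rfl | hg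
    · exact h1
    · exact (hk g hg).trans h2

end Order

/-! ### Totality, the ideals `I_k`, the modules `X̃_g` and the maps `l_f^g`. -/

namespace ProductSystem

variable {G : Type u} [Groupoid.{v} G] {P : MorphismProperty G} [P.IsMultiplicative]
  (X : ProductSystem.{u, v, w₁, w₂} P)

/-- Totality of the range of `m_{f,1}`, read through the identification of `X_{1_x}` with `A_x`. -/
theorem rsmul_total {x y : G} (f : PHom P x y) :
    (Submodule.span ℂ {ζ | ∃ (ξ : X.X f) (a : X.A x), ζ = ξ <• a}).topologicalClosure = ⊤ := by
  have hcomp : f.comp (PHom.id P x) = f := Subtype.ext (Category.id_comp f.1)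
  rw [← X.mul_total f (PHom.id P x) f hcomp]
  congr 2
  ext ζ
  constructor
  · rintro ⟨ξ, a, rfl⟩
    exact ⟨ξ, X.unit x a, (X.mul_unit f hcomp ξ a).symm⟩
  · rintro ⟨ξ, η, rfl⟩
    refine ⟨ξ, (X.unit x).symm η, ?_⟩
    rw [← X.mul_unit f hcomp, LinearEquiv.apply_symm_apply]

theorem submoduleMul_univ {x y : G} (f : PHom P x y) : X.submoduleMul f Set.univ = ⊤ := by
  rw [← X.rsmul_total f]
  simp [submoduleMul]

theorem idealI_id (x : G) : X.idealI (PHom.id P x) = Set.univ := if_pos rfl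

theorem idealI_eq_of_injective (hinj : ∀ (x y : G) (f : PHom P x y), Function.Injective (X.φ f))
    {x : G} {k : PHom P x x} (hk : k ≠ PHom.id P x) : X.idealI k = {0} := by
  ext a
  rw [idealI, if_neg hk]
  constructor
  · intro ha
    -- Among the `f` with `1 < f ≤ k` is `k` itself, and one injective `φ_k` already makes the
    -- intersection trivial.
    have h1 := ha ⟨x, k⟩ (fun e => hk (eq_of_heq (Sigma.mk.inj e).2)) (PLe.refl _)
    exact hinj _ _ k (h1.trans (map_zero _).symm)
  · rintro rfl f _ _
    exact map_zero _

theorem submoduleMul_zero {x y : G} (f : PHom P x y) : X.submoduleMul f {0} = ⊥ := by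
  have h : {ζ | ∃ ξ : X.X f, ∃ a ∈ ({0} : Set (X.A x)), ζ = ξ <• a} ⊆ {0} := by
    rintro _ ⟨ξ, a, rfl, rfl⟩
    refine eq_of_inner (X.A x) fun z => ?_
    rw [inner_rsmul, mul_zero, HilbertModule.inner_zero_right]
  refine le_bot_iff.1 (Submodule.topologicalClosure_minimal _ ?_ ?_)
  · exact Submodule.span_le.2 h
  · exact isClosed_singleton

/-- `h⁻¹g = 1` forces `h = g`, so every other summand has ideal `0` and `X̃_g` collapses to `X_g`.
-/
theorem Xtilde_apply_eq_zero (hinj : ∀ (x y : G) (f : PHom P x y), Function.Injective (X.φ f))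
    {y : G} {g : PTo P y} {ξ : ∀ h : Below g, X.X h.1} (hξ : ξ ∈ X.Xtilde g) (h : Below g)
    (hne : h.1 ≠ g.2) : ξ h = 0 := by
  have h1 := hξ.1 h
  rw [X.idealI_eq_of_injective hinj (fun e => hne (eq_of_pquot_eq_id h.2 e)),
    X.submoduleMul_zero] at h1
  exact h1

-- At `h = g` the ideal is `I_{1} = A`, so no condition falls on `x`. These families serve as test
-- vectors that recover an identity on `X_g` from one on `X̃_g`.
open Classical in
theorem single_mem_Xtilde {y : G} (g : PTo P y) (x : X.X g.2) :
    (Pi.single (⟨g.2, PLe.refl g⟩ : Below g) x : ∀ h : Below g, X.X h.1) ∈ X.Xtilde g := by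
  refine ⟨fun h => ?_, summable_of_hasFiniteSupport
    ((Set.finite_singleton (⟨g.2, PLe.refl g⟩ : Below g)).subset fun h hh => ?_)⟩
  · by_cases e : h = ⟨g.2, PLe.refl g⟩
    · subst e
      have h1 : pquot (⟨g.1, g.2⟩ : PTo P y) g (PLe.refl g) = PHom.id P g.1 := pquot_self g _
      rw [h1, idealI_id, submoduleMul_univ]
      exact Submodule.mem_top
    · rw [Pi.single_eq_of_ne e]
      exact Submodule.zero_mem _
  · by_contra e
    refine hh ?_
    change inner _ _ _ = _
    rw [Pi.single_eq_of_ne e, HilbertModule.inner_zero_right]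

/-- The multiplication `m_{f,f⁻¹g}` intertwines left actions, so `φ_f(a) ⊗ I` corresponds to
`φ_g(a)`. -/
theorem l_apply_φ {y : G} {f g : PTo P y} (h : PLe f g) (T : X.𝓛 f.2) {a : X.A y}
    (hT : T.1 = X.φ f.2 a) : (X.l f g T).1 = X.φ g.2 a := by
  refine ext_of_total (X.mul_total f.2 (pquot f g h) g.2 (comp_pquot f g h)) fun ξ η => ?_
  rw [l_mul, hT]
  exact X.mul_left _ _ _ _ a ξ η

theorem liftCompacts_eq_l {y : G} {f g : PTo P y} (h : PLe f g) (T : X.𝓚 f.2) :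
    liftCompacts (X.inner_mul f.2 (pquot f g h) g.2 (comp_pquot f g h)) (X.mul_total _ _ _ _) T =
      (X.l f g (X.ofCompact T)).1 := by
  rw [l, dif_pos h]
  rfl

/-- The left action of `b * star c` on `X_{1_x}` is a rank one operator. -/
theorem theta_unit (x : G) (b c : X.A x) :
    theta (X.A x) (X.unit x b) (X.unit x c) = X.φ (PHom.id P x) (b * star c) := by
  ext ζ
  obtain ⟨d, rfl⟩ := (X.unit x).surjective ζ
  rw [theta_apply, inner_unit, unit_rsmul, ← _root_.mul_assoc]
  exact (X.left_unit x _ d).symm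

end ProductSystem

/-! ### The maps `ψ^{(f)}` and the two implications. -/

namespace ToeplitzRep

variable {G : Type u} [Groupoid.{v} G] {P : MorphismProperty G} [P.IsMultiplicative]
  {X : ProductSystem.{u, v, w₁, w₂} P} {D : Type w₃} [NonUnitalCStarAlgebra D]
  (ψ : ToeplitzRep X D)

theorem mul_coeff {x y : G} (f : PHom P x y) (ξ : X.X f) (a : X.A x) :
    ψ.ψ f ξ * ψ.coeff x a = ψ.ψ f (ξ <• a) := by
  have hcomp : f.comp (PHom.id P x) = f := Subtype.ext (Category.id_comp f.1)
  rw [← X.mul_unit f hcomp]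
  exact ψ.map_mul f (PHom.id P x) f hcomp ξ (X.unit x a)

/-- The case `f = 1_x` of the conclusion of (1), valid for every Toeplitz representation. Elements
`d^* d` act on `X_{1_x}` by rank one operators, and they span `A_x`. -/
theorem onCompacts_φ_id (x : G) (a : X.A x) :
    ∃ ha : X.φ (PHom.id P x) a ∈ X.𝓚 (PHom.id P x),
      ψ.onCompacts (PHom.id P x) ⟨X.φ (PHom.id P x) a, ha⟩ = ψ.coeff x a := by
  have h : a ∈ Submodule.span ℂ {a : X.A x | 0 ≤ a} := by
    rw [CStarAlgebra.span_nonneg]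
    exact Submodule.mem_top
  induction h using Submodule.span_induction with
  | mem a ha =>
    obtain ⟨d, rfl⟩ := CStarAlgebra.nonneg_iff_eq_star_mul_self.1 ha
    have h1 := X.theta_unit x (star d) (star d)
    rw [star_star] at h1
    refine ⟨h1 ▸ theta_mem_compacts _ _, ?_⟩
    have h2 := ψ.onCompacts_theta (PHom.id P x) (X.unit x (star d)) (X.unit x (star d))
    simp only [h1] at h2
    rw [h2, ← ψ.map_unit_star, star_star]
    exact (ψ.map_unit_mul x _ _).symm
  | zero =>
    refine ⟨by rw [map_zero]; exact Submodule.zero_mem _, ?_⟩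
    rw [map_zero (ψ.coeff x), ← map_zero (ψ.onCompacts (PHom.id P x))]
    congr 1
    exact Subtype.ext (map_zero _)
  | add a b _ _ ha hb =>
    obtain ⟨ha, ea⟩ := ha
    obtain ⟨hb, eb⟩ := hb
    refine ⟨by rw [map_add]; exact Submodule.add_mem _ ha hb, ?_⟩
    rw [map_add (ψ.coeff x), ← ea, ← eb, ← map_add (ψ.onCompacts (PHom.id P x))]
    congr 1
    exact Subtype.ext (map_add _ _ _)
  | smul c a _ ha =>
    obtain ⟨ha, ea⟩ := ha
    refine ⟨by rw [map_smul]; exact Submodule.smul_mem _ c ha, ?_⟩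
    rw [map_smul (ψ.coeff x), ← ea, ← map_smul (ψ.onCompacts (PHom.id P x))]
    congr 1
    exact Subtype.ext (map_smul _ _ _)

/-- Both sides are continuous and linear in `S`. For `S = θ_{μ,ν}` each equals `ψ_g(ξ) ψ_f(μ)
ψ_f(ν)^* ψ_g(η)^*`. -/
theorem onCompacts_sandwich {x y z : G} (g : PHom P y z) (f : PHom P x y) (k : PHom P x z)
    (h : g.comp f = k) (ξ η : X.X g) (S : X.𝓚 f) :
    ψ.onCompacts k ⟨sandwich (X.left f) (X.inner_mul g f k h) ξ η S.1,
        sandwich_mem_compacts (X.inner_mul g f k h) (X.mul_total g f k h) (X.mul_right g f k h)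
          ξ η S.2⟩ =
      ψ.ψ g ξ * ψ.onCompacts f S * star (ψ.ψ g η) := by
  let Λ : X.𝓚 f →L[ℂ] X.𝓚 k :=
    ((sandwich (X.left f) (X.inner_mul g f k h) ξ η).comp (X.𝓚 f).subtypeL).codRestrict (X.𝓚 k)
      fun S => sandwich_mem_compacts (X.inner_mul g f k h) (X.mul_total g f k h)
        (X.mul_right g f k h) ξ η S.2
  let M : D →L[ℂ] D := ContinuousLinearMap.mul ℂ D (ψ.ψ g ξ)
  let N : D →L[ℂ] D := (ContinuousLinearMap.mul ℂ D).flip (star (ψ.ψ g η))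
  let p : X.𝓚 f →L[ℂ] D := (ψ.onCompacts k).comp Λ
  let q : X.𝓚 f →L[ℂ] D := N.comp (M.comp (ψ.onCompacts f))
  have hpq : LinearMap.eqLocus (p : X.𝓚 f →ₗ[ℂ] D) (q : X.𝓚 f →ₗ[ℂ] D) = ⊤ := by
    refine eq_top_of_theta_mem (isClosed_eq p.continuous q.continuous)
      span_univ_topologicalClosure fun μ _ ν => ?_
    change ψ.onCompacts k (Λ ⟨theta (X.A x) μ ν, theta_mem_compacts μ ν⟩) =
      ψ.ψ g ξ * ψ.onCompacts f ⟨theta (X.A x) μ ν, theta_mem_compacts μ ν⟩ * star (ψ.ψ g η)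
    have e : Λ ⟨theta (X.A x) μ ν, theta_mem_compacts μ ν⟩ =
        ⟨theta (X.A x) (X.mul g f k h ξ μ) (X.mul g f k h η ν), theta_mem_compacts _ _⟩ :=
      Subtype.ext (sandwich_theta (X.inner_mul g f k h) (X.mul_total g f k h)
        (X.mul_right g f k h) ξ η μ ν)
    rw [e, onCompacts_theta, onCompacts_theta, ← ψ.map_mul g f k h, ← ψ.map_mul g f k h, star_mul]
    simp only [mul_assoc]
  have hS : S ∈ LinearMap.eqLocus (p : X.𝓚 f →ₗ[ℂ] D) (q : X.𝓚 f →ₗ[ℂ] D) :=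
    hpq ▸ Submodule.mem_top
  exact hS

/-- If the left actions are by compact operators and `ψ^{(f)} ∘ φ_f = ψ_{1_{t(f)}}` for all `f`, then
`l_f^g` maps compact operators to compact operators, and `ψ^{(g)} ∘ l_f^g = ψ^{(f)}` on `𝓚(X_f)`. -/
theorem onCompacts_l
    (H : ∀ (x y : G) (f : PHom P x y) (a : X.A y),
      ∃ ha : X.φ f a ∈ X.𝓚 f, ψ.onCompacts f ⟨X.φ f a, ha⟩ = ψ.coeff y a)
    {y : G} {f g : PTo P y} (h : PLe f g) (T : X.𝓚 f.2) :
    ∃ hT : (X.l f g (X.ofCompact T)).1 ∈ X.𝓚 g.2,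
      ψ.onCompacts g.2 ⟨(X.l f g (X.ofCompact T)).1, hT⟩ = ψ.onCompacts f.2 T := by
  have hm := X.inner_mul f.2 (pquot f g h) g.2 (comp_pquot f g h)
  have htot := X.mul_total f.2 (pquot f g h) g.2 (comp_pquot f g h)
  have hb := X.mul_balanced f.2 (pquot f g h) g.2 (comp_pquot f g h)
  have hr := X.mul_right f.2 (pquot f g h) g.2 (comp_pquot f g h)
  have hmem : ∀ T : X.𝓚 f.2, liftCompacts hm htot T ∈ X.𝓚 g.2 := fun T => by
    have hq : (X.𝓚 g.2).comap (liftCompacts hm htot : X.𝓚 f.2 →ₗ[ℂ] (X.X g.2 →L[ℂ] X.X g.2)) =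
        ⊤ := by
      -- Generators `ξa` are needed instead of arbitrary vectors: the factor `a` places the compact
      -- operator `φ(a)` between creation and annihilation operators.
      refine eq_top_of_theta_mem (isClosed_compacts.preimage (liftCompacts hm htot).continuous)
        (X.rsmul_total f.2) ?_
      rintro _ ⟨ξ, a, rfl⟩ η
      change lift _ (theta (X.A f.1) (ξ <• a) η) ∈ X.𝓚 g.2
      rw [lift_theta_rsmul hm htot hb]
      exact sandwich_mem_compacts hm htot hr ξ η (H _ _ (pquot f g h) a).1
    exact (hq ▸ Submodule.mem_top : T ∈ (X.𝓚 g.2).comap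
      (liftCompacts hm htot : X.𝓚 f.2 →ₗ[ℂ] (X.X g.2 →L[ℂ] X.X g.2)))
  let Λ : X.𝓚 f.2 →L[ℂ] X.𝓚 g.2 := (liftCompacts hm htot).codRestrict (X.𝓚 g.2) hmem
  let p : X.𝓚 f.2 →L[ℂ] D := (ψ.onCompacts g.2).comp Λ
  have hp : LinearMap.eqLocus (p : X.𝓚 f.2 →ₗ[ℂ] D) (ψ.onCompacts f.2 : X.𝓚 f.2 →ₗ[ℂ] D) = ⊤ := by
    refine eq_top_of_theta_mem (isClosed_eq p.continuous (ψ.onCompacts f.2).continuous)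
      (X.rsmul_total f.2) ?_
    rintro _ ⟨ξ, a, rfl⟩ η
    change ψ.onCompacts g.2 (Λ _) = ψ.onCompacts f.2 _
    obtain ⟨ha, ea⟩ := H _ _ (pquot f g h) a
    have e : Λ ⟨theta (X.A f.1) (ξ <• a) η, theta_mem_compacts _ _⟩ =
        ⟨sandwich (X.left (pquot f g h)) hm ξ η (X.φ (pquot f g h) a),
          sandwich_mem_compacts hm htot hr ξ η ha⟩ :=
      Subtype.ext (lift_theta_rsmul hm htot hb ξ η a)
    -- The hypothesis enters here: `ψ_f(ξa) = ψ_f(ξ) ψ_{1}(a)`, and `ψ_{1}(a)` is replaced by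
    -- `ψ^{(f⁻¹g)}(φ(a))`.
    rw [e, ψ.onCompacts_theta, ← ψ.mul_coeff, ← ea]
    exact ψ.onCompacts_sandwich f.2 (pquot f g h) g.2 (comp_pquot f g h) ξ η ⟨_, ha⟩
  have hT : T ∈ LinearMap.eqLocus (p : X.𝓚 f.2 →ₗ[ℂ] D) (ψ.onCompacts f.2 : X.𝓚 f.2 →ₗ[ℂ] D) :=
    hp ▸ Submodule.mem_top
  have hl := X.liftCompacts_eq_l h T
  refine ⟨hl ▸ hmem T, Eq.trans ?_ hT⟩
  change _ = ψ.onCompacts g.2 (Λ T)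
  congr 1
  exact Subtype.ext hl.symm

theorem onCompacts_φ_of_isCuntzPimsnerCovariant
    (hjoin : ∀ (y : G) (f g : PTo P y), ∃ k : PTo P y, IsJoin f g k)
    (hinj : ∀ (x y : G) (f : PHom P x y), Function.Injective (X.φ f))
    (hψ : ψ.IsCuntzPimsnerCovariant) {x y : G} (f : PHom P x y) (a : X.A y)
    (ha : X.φ f a ∈ X.𝓚 f) : ψ.onCompacts f ⟨X.φ f a, ha⟩ = ψ.coeff y a := by
  classical
  obtain ⟨ha', ea⟩ := ψ.onCompacts_φ_id y a
  -- For `f = 1_y` the two operators below would share one index, so this case is taken from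
  -- `onCompacts_φ_id`.
  by_cases hf : (⟨x, f⟩ : PTo P y) = PTo.one P y
  · obtain ⟨rfl, hf⟩ := Sigma.mk.inj hf
    obtain rfl := eq_of_heq hf
    exact ea
  let T : ∀ k : PTo P y, X.𝓚 k.2 := Function.update (Function.update 0
    (PTo.one P y) (-⟨X.φ (PHom.id P y) a, ha'⟩)) ⟨x, f⟩ ⟨X.φ f a, ha⟩
  have hT : T ⟨x, f⟩ = ⟨X.φ f a, ha⟩ := Function.update_self _ _ _
  have hT' : T (PTo.one P y) = -⟨X.φ (PHom.id P y) a, ha'⟩ := by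
    simp only [T]
    rw [Function.update_of_ne (Ne.symm hf), Function.update_self]
  have h := hψ y {⟨x, f⟩, PTo.one P y} T fun k => ?_
  · rw [Finset.sum_pair hf, hT, hT', map_neg, add_neg_eq_zero] at h
    exact h.trans ea
  -- Beyond `f ∨ k` every `g` lies above `f`, so both maps `l` are given by the nonzero branch at `h
  -- = g`.
  obtain ⟨j, hj, hk, -⟩ := hjoin y ⟨x, f⟩ k
  refine ⟨j, hk, fun g hg ξ hξ => ?_⟩
  rw [Finset.sum_pair hf]
  funext h
  change (X.l ⟨x, f⟩ ⟨g.1, h.1⟩ (X.ofCompact (T ⟨x, f⟩))).1 (ξ h) +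
    (X.l (PTo.one P y) ⟨g.1, h.1⟩ (X.ofCompact (T (PTo.one P y)))).1 (ξ h) = 0
  -- At `h = g` the two terms are `φ_g(a)` and `φ_g(-a)`; at every other `h` the component of `ξ` is
  -- zero.
  by_cases hh : h.1 = g.2
  · have hfh : PLe ⟨x, f⟩ (⟨g.1, h.1⟩ : PTo P y) := by
      rw [hh]
      exact hj.trans hg
    rw [X.l_apply_φ hfh (X.ofCompact (T ⟨x, f⟩)) (a := a) (by rw [hT]; rfl),
      X.l_apply_φ (PTo.one_le _) (X.ofCompact (T (PTo.one P y))) (a := -a)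
        (by rw [hT', map_neg]; rfl), map_neg, neg_apply, add_neg_cancel]
  · rw [X.Xtilde_apply_eq_zero hinj hξ h hh, map_zero, map_zero, add_zero]

theorem isCuntzPimsnerCovariant_of_onCompacts_φ
    (hjoin : ∀ (y : G) (f g : PTo P y), ∃ k : PTo P y, IsJoin f g k)
    (H : ∀ (x y : G) (f : PHom P x y) (a : X.A y),
      ∃ ha : X.φ f a ∈ X.𝓚 f, ψ.onCompacts f ⟨X.φ f a, ha⟩ = ψ.coeff y a) :
    ψ.IsCuntzPimsnerCovariant := by
  classical
  intro y F T hlarge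
  obtain ⟨k, hk⟩ := exists_upper_bound (hjoin y) F
  -- A single `g` above all of `F` is enough.
  obtain ⟨g, hkg, hg⟩ := hlarge k
  have hsum : ∑ f ∈ F, (X.l f g (X.ofCompact (T f))).1 = 0 := by
    ext x
    have h1 := congrFun (hg g (PLe.refl g) _ (X.single_mem_Xtilde g x)) ⟨g.2, PLe.refl g⟩
    rw [Finset.sum_apply] at h1
    simp only [ProductSystem.ltilde, Pi.single_eq_same] at h1
    rw [sum_apply]
    exact h1
  have hl := fun f (hf : f ∈ F) => ψ.onCompacts_l H ((hk f hf).trans hkg) (T f)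
  calc ∑ f ∈ F, ψ.onCompacts f.2 (T f)
      -- Compactness of `l_f^g (T_f)` depends on `f ≤ g`, hence on `f ∈ F`, so the sum runs over
      -- `F.attach`.
      = ∑ f ∈ F.attach, ψ.onCompacts g.2 ⟨_, (hl f.1 f.2).1⟩ := by
        rw [← Finset.sum_attach]
        exact Finset.sum_congr rfl fun f _ => (hl f.1 f.2).2.symm
    _ = ψ.onCompacts g.2 (∑ f ∈ F.attach, ⟨_, (hl f.1 f.2).1⟩) := (map_sum _ _ _).symm
    _ = ψ.onCompacts g.2 0 := by
        congr 1
        refine Subtype.ext ?_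
        rw [Submodule.coe_sum, Submodule.coe_zero, ← hsum]
        exact Finset.sum_attach F fun f => (X.l f g (X.ofCompact (T f))).1
    _ = 0 := map_zero _

end ToeplitzRep

end PSys

theorem mainTheorem4 {G : Type u} [CategoryTheory.Groupoid.{v} G]
    (P : CategoryTheory.MorphismProperty G) [P.IsMultiplicative]
    (hP : PSys.IsQuasiLatticeOrdered P)
    (X : PSys.ProductSystem.{u, v, w₁, w₂} P) (hX : X.IsCompactlyAligned)
    {D : Type w₃} [NonUnitalCStarAlgebra D] (ψ : PSys.ToeplitzRep X D)
    (hjoin : ∀ (y : G) (f g : PSys.PTo P y), ∃ k : PSys.PTo P y, PSys.IsJoin f g k)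
    (hinj : ∀ (x y : G) (f : PSys.PHom P x y), Function.Injective (X.φ f)) :
    (ψ.IsCuntzPimsnerCovariant →
      ∀ (x y : G) (f : PSys.PHom P x y) (a : X.A y) (ha : X.φ f a ∈ X.𝓚 f),
        ψ.onCompacts f ⟨X.φ f a, ha⟩ = ψ.coeff y a) ∧
    ((∀ (x y : G) (f : PSys.PHom P x y) (a : X.A y),
        ∃ ha : X.φ f a ∈ X.𝓚 f, ψ.onCompacts f ⟨X.φ f a, ha⟩ = ψ.coeff y a) →
      ψ.IsCuntzPimsnerCovariant) := by
  exact ⟨fun hψ _ _ f a ha => ψ.onCompacts_φ_of_isCuntzPimsnerCovariant hjoin hinj hψ f a ha,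
    ψ.isCuntzPimsnerCovariant_of_onCompacts_φ hjoin⟩
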